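/- Let $0<\delta<1$. For $\alpha\in(\delta-1,1-\delta)$ let $G_{\alpha,\delta}$ be the Green function with pole at infinity of the domain $\overline{\mathbb C}\setminus E(\alpha,\delta)$, $E(\alpha,\delta)=[-1,1]\setminus(\alpha-\delta,\alpha+\delta)$, and let $G_\delta$ be the Green function with pole at infinity of $\overline{\mathbb C}\setminus[-1+2\delta,1]$; both are extended by $0$ to the removed set. For every $\alpha\in(\delta-1,0]$ and every $x$ in the gap $(\alpha-\delta,\alpha+\delta)$ the derivative $\partial_\alpha G_{\alpha,\delta}(x)$ exists, and the equation $\partial_\alpha G_{\alpha,\delta}(x)=0$ has exactly one solution $x=x_0(\alpha)$ in the gap. Let $x_0\in(-1,0]$. Then the supremum $$\Phi_\delta(x_0)=\sup_{\alpha\in(\delta-1,0]}G_{\alpha,\delta}(x_0)$$ is finite. If it is attained at some $\alpha\in(\delta-1,0]$, then $x_0\in(\alpha-\delta,\alpha+\delta)$ and $x_0=x_0(\alpha)$, i.e. $x_0$ is the unique solution $x$ in $(\alpha-\delta,\alpha+\delta)$ of $\partial_\alpha G_{\alpha,\delta}(x)=0$. If it is not attained at any $\alpha\in(\delta-1,0]$,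 then $\Phi_\delta(x_0)=\lim_{\alpha\to(\delta-1)^+}G_{\alpha,\delta}(x_0)=G_\delta(x_0)$. -/

import Mathlib

open Set Filter Topology

/-- `g` is the Green function, with pole at infinity, of the complement of the compact set `E` in
the Riemann sphere, extended by zero to `E`: it is harmonic on `ℂ \ E`, differs from `log |z|` by
a bounded function near infinity, and has boundary values zero on `E` (continuity on the whole
plane together with vanishing on `E`). By the maximum principle there is at most one such `g` when
`E` is nonempty and compact. -/
structure IsGreenAtInfty (E : Set ℂ) (g : ℂ → ℝ) : Prop where
  harmonic : InnerProductSpace.HarmonicOnNhd g Eᶜ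
  continuous : Continuous g
  eq_zero : ∀ z ∈ E, g z = 0
  log_pole : (fun z : ℂ => g z - Real.log ‖z‖) =O[Bornology.cobounded ℂ] (fun _ => (1 : ℝ))

open Classical in
/-- The Green function of the complement of `E` with pole at infinity (`0` if there is none). -/
noncomputable def greenAtInfty (E : Set ℂ) : ℂ → ℝ :=
  if h : ∃ g, IsGreenAtInfty E g then h.choose else 0

/-- `E(α, δ) = [-1, 1] \ (α - δ, α + δ)`, as a subset of the complex plane. -/
def twoIntervals (α δ : ℝ) : Set ℂ :=
  (fun t : ℝ => (t : ℂ)) '' (Icc (-1) 1 \ Ioo (α - δ) (α + δ))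

/-- `E(δ) = [-1 + 2δ, 1]`, as a subset of the complex plane. -/
def oneInterval (δ : ℝ) : Set ℂ :=
  (fun t : ℝ => (t : ℂ)) '' Icc (-1 + 2 * δ) 1

/-- `G_{α,δ}(x)` for real `x`. -/
noncomputable def greenTwo (α δ x : ℝ) : ℝ := greenAtInfty (twoIntervals α δ) (x : ℂ)

/-- `G_δ(x)` for real `x`. -/
noncomputable def greenOne (δ x : ℝ) : ℝ := greenAtInfty (oneInterval δ) (x : ℂ)

/-- The upper envelope `Φ_δ(x) = sup_{α ∈ (δ - 1, 0]} G_{α,δ}(x)`. -/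
noncomputable def upperEnvelope (δ x : ℝ) : ℝ :=
  sSup ((fun α : ℝ => greenTwo α δ x) '' Ioc (δ - 1) 0)

/-! Everything rests on an explicit formula for the Green function in the gap. Its complex
derivative is $(z-c)/\sqrt{(z^2-1)((z-\alpha)^2-\delta^2)}$, where the critical point
$c=\alpha+\gamma(\alpha)$ is fixed by the requirement that the integral over the gap vanishes. The
substitution $t=\alpha-\delta\cos\varphi$ removes the endpoint singularities and gives
$G_{\alpha,\delta}(x)=-\int_\theta^\pi(\gamma+\delta\cos\varphi)\,w\,d\varphi$ with
$w=(1-(\alpha-\delta\cos\varphi)^2)^{-1/2}$ and $\cos\theta=(\alpha-x)/\delta$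
(`greenTwo_eq_gapGreen`). In this form both integrand and limit can be differentiated in $\alpha$.

Differentiating $\partial_\alpha G$ once more, along $\theta$, yields
$w\,(\gamma'+(\delta+\gamma\cos\theta)/(\delta\sin^2\theta))$. This is positive because
$|\gamma|<\delta$ (`abs_critOffset_lt`) and $\gamma'\ge0$ (`critOffsetDeriv_nonneg`, a correlation
inequality). Hence $\partial_\alpha G$ is strictly increasing in $x$ across the gap; it changes sign
there, so it has exactly one zero.

At a maximizing $\alpha$ the point $x_0$ lies in the gap, since $G$ is positive in the gap, zero on
the bands, and some admissible gap contains $x_0$. For $\alpha<0$ Fermat's theorem applies. At the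
endpoint $\alpha=0$ only a one-sided inequality is available; evenness in $\alpha$ at $x=0$ and the
monotonicity in $x$ rule out a nonzero derivative.

As $\alpha\to\delta-1$ the integral of $w$ diverges, which forces $\gamma\to-\delta$; bounded
convergence then gives the limit $G_\delta(x_0)$ (`tendsto_greenTwo`). Thus $G$ extends continuously
to $[\delta-1,0]$, and compactness gives finiteness and the alternative between an attained supremum
and the limit. -/

/-! ### Maximum principle and uniqueness of the Green function. -/

theorem InnerProductSpace.HarmonicAt.eventually_eq_of_isLocalMax {v : ℂ → ℝ} {z : ℂ}
    (hv : InnerProductSpace.HarmonicAt v z) (hmax : IsLocalMax v z) :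
    ∀ᶠ y in 𝓝 z, v y = v z := by
  obtain ⟨R, hR, hball⟩ := Metric.eventually_nhds_iff_ball.1 hv.eventually
  obtain ⟨F, hF, hFv⟩ := InnerProductSpace.HarmonicOnNhd.exists_analyticOnNhd_ball_re_eq
    (f := v) (z := z) (R := R) hball
  have hnhds : Metric.ball z R ∈ 𝓝 z := Metric.ball_mem_nhds z hR
  -- Since $|e^F|=e^v$, the maximum modulus principle for $e^F$ is the maximum principle for $v$.
  have hnorm : ∀ y ∈ Metric.ball z R, ‖Complex.exp (F y)‖ = Real.exp (v y) := by
    intro y hy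
    rw [Complex.norm_exp]
    exact congrArg _ (hFv hy)
  have hd : ∀ᶠ y in 𝓝 z, DifferentiableAt ℂ (fun y => Complex.exp (F y)) y := by
    filter_upwards [hnhds] with y hy
    exact (hF y hy).differentiableAt.cexp
  have hloc : IsLocalMax (norm ∘ fun y => Complex.exp (F y)) z := by
    filter_upwards [hnhds, hmax] with y hy hle
    simp only [Function.comp]
    rw [hnorm y hy, hnorm z (Metric.mem_ball_self hR)]
    exact Real.exp_le_exp.2 hle
  filter_upwards [hnhds, Complex.eventually_eq_of_isLocalMax_norm hd hloc] with y hy he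
  have := congrArg norm he
  rw [hnorm y hy, hnorm z (Metric.mem_ball_self hR)] at this
  exact Real.exp_injective this

/-- Maximum principle: a function continuous on the plane, harmonic off `E`, nonpositive on `E`
and tending to `-∞` at infinity is nonpositive. -/
theorem nonpos_of_harmonicOnNhd_compl {E : Set ℂ} (hE : E.Nonempty) {v : ℂ → ℝ}
    (hv : InnerProductSpace.HarmonicOnNhd v Eᶜ) (hc : Continuous v) (h0 : ∀ z ∈ E, v z ≤ 0)
    (hbot : Tendsto v (Bornology.cobounded ℂ) atBot) (z : ℂ) : v z ≤ 0 := by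
  obtain ⟨m, hm⟩ : ∃ m, ∀ y, v y ≤ v m := 
    hc.exists_forall_ge (by rwa [← Metric.cobounded_eq_cocompact])
  set M : Set ℂ := {y | v y = v m}
  by_cases hME : (M ∩ E).Nonempty
  · obtain ⟨y, hyM, hyE⟩ := hME
    exact (hm z).trans (hyM.symm.le.trans (h0 y hyE))
  · have hopen : IsOpen M := by
      rw [isOpen_iff_mem_nhds]
      intro y hy
      have hyE : y ∉ E := fun h => hME ⟨y, hy, h⟩
      have := (hv y hyE).eventually_eq_of_isLocalMax
        (Eventually.of_forall fun w => (hm w).trans (Eq.ge hy))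
      filter_upwards [this] with w hw
      exact hw.trans hy
    have hclosed : IsClosed M := isClosed_eq hc continuous_const
    have huniv : M = univ := IsClopen.eq_univ ⟨hclosed, hopen⟩ ⟨m, rfl⟩
    obtain ⟨e, he⟩ := hE
    exact absurd ⟨e, huniv ▸ mem_univ e, he⟩ hME

namespace IsGreenAtInfty

theorem tendsto_atTop {E : Set ℂ} {g : ℂ → ℝ} (hg : IsGreenAtInfty E g) :
    Tendsto g (Bornology.cobounded ℂ) atTop := by
  obtain ⟨C, hC⟩ := hg.log_pole.bound
  have hlog : Tendsto (fun z : ℂ => Real.log ‖z‖ - C) (Bornology.cobounded ℂ) atTop :=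
    tendsto_atTop_add_const_right _ _ (Real.tendsto_log_atTop.comp tendsto_norm_cobounded_atTop)
  refine tendsto_atTop_mono' _ ?_ hlog
  filter_upwards [hC] with z hz
  have := abs_le.1 hz
  simp at this
  linarith [this.1]

/-- The difference $g_1-g_2$ is only known to be bounded at infinity. Subtracting $\varepsilon g_1$
makes it tend to $-\infty$, so the maximum principle applies, and then $\varepsilon\to0$. -/
theorem le {E : Set ℂ} (hE : E.Nonempty) {g₁ g₂ : ℂ → ℝ} (h₁ : IsGreenAtInfty E g₁)
    (h₂ : IsGreenAtInfty E g₂) (z : ℂ) : g₁ z ≤ g₂ z := by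
  have key : ∀ ε > 0, g₁ z - g₂ z ≤ ε * g₁ z := by
    intro ε hε
    have hharm : InnerProductSpace.HarmonicOnNhd (g₁ - g₂ - ε • g₁) Eᶜ :=
      (h₁.harmonic.sub h₂.harmonic).sub h₁.harmonic.const_smul
    have hcont : Continuous (g₁ - g₂ - ε • g₁) :=
      (h₁.continuous.sub h₂.continuous).sub (h₁.continuous.const_smul ε)
    have hbot : Tendsto (g₁ - g₂ - ε • g₁) (Bornology.cobounded ℂ) atBot := by
      obtain ⟨C, hC⟩ := (h₁.log_pole.sub h₂.log_pole).bound
      have : Tendsto (fun z => C + (-ε) * g₁ z) (Bornology.cobounded ℂ) atBot :=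
        tendsto_atBot_add_const_left _ _
          (h₁.tendsto_atTop.const_mul_atTop_of_neg (by linarith))
      refine tendsto_atBot_mono' _ ?_ this
      filter_upwards [hC] with w hw
      have := (abs_le.1 hw).2
      simp at this ⊢
      linarith
    have := nonpos_of_harmonicOnNhd_compl hE hharm hcont
      (fun w hw => by simp [h₁.eq_zero w hw, h₂.eq_zero w hw]) hbot z
    simp at this
    linarith
  have hlim : Tendsto (fun ε : ℝ => ε * g₁ z) (𝓝[>] 0) (𝓝 0) := by
    have : Tendsto (fun ε : ℝ => ε * g₁ z) (𝓝 0) (𝓝 (0 * g₁ z)) := by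
      exact (continuous_id.mul continuous_const).tendsto 0
    rw [zero_mul] at this
    exact this.mono_left nhdsWithin_le_nhds
  have := ge_of_tendsto hlim (eventually_mem_nhdsWithin.mono fun ε hε => key ε hε)
  linarith

theorem greenAtInfty_eq {E : Set ℂ} (hE : E.Nonempty) {g : ℂ → ℝ} (hg : IsGreenAtInfty E g) :
    greenAtInfty E = g := by
  have hex : ∃ g, IsGreenAtInfty E g := ⟨g, hg⟩
  rw [greenAtInfty, dif_pos hex]
  funext z
  exact le_antisymm (hex.choose_spec.le hE hg z) (hg.le hE hex.choose_spec z)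

end IsGreenAtInfty

/-! ### A square root continuous on the closed upper half-plane. -/

/-- The branch of the square root that is holomorphic off the half-line `-i [0, ∞)` and maps the
upper half-plane into the first quadrant. -/
noncomputable def upperSqrt (z : ℂ) : ℂ :=
  ((√2 : ℝ) : ℂ)⁻¹ * (1 + Complex.I) * Complex.sqrt (-Complex.I * z)

theorem complex_sqrt_sq (z : ℂ) : Complex.sqrt z ^ 2 = z := by
  rw [Complex.sqrt, ← Complex.cpow_mul_nat]
  norm_num

theorem upperSqrt_sq (z : ℂ) : upperSqrt z ^ 2 = z := by
  have h2 : ((√2 : ℝ) : ℂ) ^ 2 = 2 := by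
    rw [← Complex.ofReal_pow, Real.sq_sqrt (by norm_num)]; norm_num
  rw [upperSqrt, mul_pow, mul_pow, complex_sqrt_sq, inv_pow, h2]
  linear_combination (-(1 / 2) * z * (Complex.I + 2)) * Complex.I_sq

theorem upperSqrt_ne_zero {z : ℂ} (hz : z ≠ 0) : upperSqrt z ≠ 0 := by
  intro h
  apply hz
  rw [← upperSqrt_sq z, h]
  simp

theorem norm_upperSqrt (z : ℂ) : ‖upperSqrt z‖ = √‖z‖ := by
  rw [eq_comm, Real.sqrt_eq_iff_mul_self_eq (norm_nonneg _) (norm_nonneg _), ← sq, ← norm_pow,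
    upperSqrt_sq]

theorem hasDerivAt_upperSqrt {z : ℂ} (hz : 0 < z.im ∨ z.re ≠ 0) :
    HasDerivAt upperSqrt (1 / (2 * upperSqrt z)) z := by
  have hslit : -Complex.I * z ∈ Complex.slitPlane := by
    rw [Complex.mem_slitPlane_iff]
    simpa using hz
  have hz0 : z ≠ 0 := by
    rintro rfl
    simp at hz
  have hd : DifferentiableAt ℂ upperSqrt z := by
    unfold upperSqrt
    exact ((Complex.differentiableAt_sqrt hslit).comp z
      (differentiableAt_id.const_mul (-Complex.I))).const_mul _
  have h1 := hd.hasDerivAt.pow 2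
  have h2 : HasDerivAt (upperSqrt ^ 2) 1 z := by
    have : upperSqrt ^ 2 = id := by
      funext w
      exact upperSqrt_sq w
    rw [this]
    exact hasDerivAt_id z
  have h3 := h1.unique h2
  have hne := upperSqrt_ne_zero hz0
  convert! hd.hasDerivAt using 1
  field_simp
  norm_num at h3
  linear_combination -h3

/-- The cut meets the closed upper half-plane only at $0$, where $|\sqrt z|=\sqrt{|z|}$ gives
continuity. -/
theorem continuousAt_upperSqrt {z : ℂ} (hz : 0 ≤ z.im) : ContinuousAt upperSqrt z := by
  by_cases h : 0 < z.im ∨ z.re ≠ 0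
  · exact (hasDerivAt_upperSqrt h).continuousAt
  · push Not at h
    have hz0 : z = 0 := Complex.ext h.2 (le_antisymm h.1 hz)
    have h0 : upperSqrt 0 = 0 := by simpa using norm_upperSqrt 0
    rw [hz0, ContinuousAt, h0, tendsto_zero_iff_norm_tendsto_zero]
    simp only [norm_upperSqrt]
    have : Continuous fun w : ℂ => √‖w‖ := by fun_prop
    simpa using this.tendsto 0

theorem upperSqrt_re (z : ℂ) : (upperSqrt z).re =
    (√2)⁻¹ * ((Complex.sqrt (-Complex.I * z)).re - (Complex.sqrt (-Complex.I * z)).im) := by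
  rw [upperSqrt, mul_assoc, ← Complex.ofReal_inv, Complex.re_ofReal_mul, Complex.mul_re]
  simp only [Complex.add_re, Complex.one_re, Complex.I_re, Complex.add_im, Complex.one_im,
    Complex.I_im]
  ring

theorem upperSqrt_im (z : ℂ) : (upperSqrt z).im =
    (√2)⁻¹ * ((Complex.sqrt (-Complex.I * z)).re + (Complex.sqrt (-Complex.I * z)).im) := by
  rw [upperSqrt, mul_assoc, ← Complex.ofReal_inv, Complex.im_ofReal_mul, Complex.mul_im]
  simp only [Complex.add_re, Complex.one_re, Complex.I_re, Complex.add_im, Complex.one_im,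
    Complex.I_im]
  ring

theorem inv_sqrt_two_mul_add_self (y : ℝ) : (√2)⁻¹ * (√(y / 2) + √(y / 2)) = √y := by
  rw [Real.sqrt_div' y (by norm_num : (0 : ℝ) ≤ 2)]
  have hs : √2 * √2 = 2 := Real.mul_self_sqrt (by norm_num)
  field_simp
  rw [sq, hs]
  ring

theorem upperSqrt_ofReal_of_nonneg {x : ℝ} (hx : 0 ≤ x) : upperSqrt x = (√x : ℝ) := by
  rcases hx.eq_or_lt with rfl | hx'
  · simpa using norm_upperSqrt 0
  have hs : Complex.sqrt (-Complex.I * x) = √(x / 2) - √(x / 2) * Complex.I := by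
    rw [Complex.sqrt_eq_real_add_ite]
    simp [abs_of_pos hx', not_le.2 hx']
    ring
  apply Complex.ext
  · rw [upperSqrt_re, hs, Complex.ofReal_re, ← inv_sqrt_two_mul_add_self x]
    simp
  · rw [upperSqrt_im, hs]
    simp

theorem upperSqrt_ofReal_of_nonpos {x : ℝ} (hx : x ≤ 0) :
    upperSqrt x = Complex.I * (√(-x) : ℝ) := by
  have hs : Complex.sqrt (-Complex.I * x) = √(-x / 2) + √(-x / 2) * Complex.I := by
    rw [Complex.sqrt_eq_real_add_ite]
    simp [abs_of_nonpos hx, hx]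
  apply Complex.ext
  · rw [upperSqrt_re, hs]
    simp
  · rw [upperSqrt_im, hs]
    have := inv_sqrt_two_mul_add_self (-x)
    simpa using this

theorem upperSqrt_re_pos_im_pos {z : ℂ} (hz : 0 < z.im) :
    0 < (upperSqrt z).re ∧ 0 < (upperSqrt z).im := by
  set p := Complex.sqrt (-Complex.I * z)
  have hp : p ^ 2 = -Complex.I * z := complex_sqrt_sq _
  have hre : 0 ≤ p.re := by
    simp only [p]
    rw [Complex.sqrt, Complex.cpow_inv_two_re]
    positivity
  have h1 : p.re ^ 2 - p.im ^ 2 = z.im := by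
    have := congrArg Complex.re hp
    simp [sq] at this
    linarith
  have h2 : |p.im| < p.re := by
    rw [← abs_of_nonneg hre]
    exact sq_lt_sq.1 (by linarith)
  have h3 := abs_lt.1 h2
  have hs : 0 < (√2)⁻¹ := by positivity
  constructor
  · rw [upperSqrt_re]
    exact mul_pos hs (by linarith)
  · rw [upperSqrt_im]
    exact mul_pos hs (by linarith)

/-! ### Primitives of the algebraic derivative on the upper half-plane. -/

/-- The function `n(z) / ∏ √(z - e)`, the product being over `e ∈ S`. -/
noncomputable def branchQuot (n : ℂ → ℂ) (S : Finset ℝ) (z : ℂ) : ℂ :=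
  n z / ∏ e ∈ S, upperSqrt (z - e)

theorem differentiableAt_branchQuot {n : ℂ → ℂ} (hn : Differentiable ℂ n) {S : Finset ℝ} {z : ℂ}
    (hz : ∀ e ∈ S, 0 < z.im ∨ z.re ≠ e) : DifferentiableAt ℂ (branchQuot n S) z := by
  have hz' : ∀ e ∈ S, 0 < (z - e).im ∨ (z - e).re ≠ 0 := by
    intro e he
    simpa [sub_ne_zero] using hz e he
  refine (hn z).div (DifferentiableAt.fun_finsetProd fun e he => ?_)
    (Finset.prod_ne_zero_iff.2 fun e he => upperSqrt_ne_zero ?_)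
  · exact (hasDerivAt_upperSqrt (hz' e he)).differentiableAt.comp (f := fun w : ℂ => w - (e : ℂ)) z
      (differentiableAt_id.sub_const (e : ℂ))
  · intro h
    have := hz' e he
    simp [h] at this

/-- The Cayley transform carries the problem to the unit disc, where holomorphic functions have
primitives. -/
theorem exists_primitive_of_differentiableOn_upperHalfPlane {f : ℂ → ℂ}
    (hf : ∀ z : ℂ, 0 < z.im → DifferentiableAt ℂ f z) :
    ∃ F : ℂ → ℂ, ∀ z : ℂ, 0 < z.im → HasDerivAt F (f z) z := by
  set c : ℂ → ℂ := fun ζ => Complex.I * (1 + ζ) / (1 - ζ)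
  have hne : ∀ ζ ∈ Metric.ball (0 : ℂ) 1, 1 - ζ ≠ 0 := by
    intro ζ hζ h
    have : ζ = 1 := by linear_combination -h
    simp [this] at hζ
  have hc : ∀ ζ ∈ Metric.ball (0 : ℂ) 1, HasDerivAt c (2 * Complex.I / (1 - ζ) ^ 2) ζ := by
    intro ζ hζ
    have h1 : HasDerivAt (fun ζ : ℂ => Complex.I * (1 + ζ)) Complex.I ζ := by
      simpa using ((hasDerivAt_id ζ).const_add 1).const_mul Complex.I
    have h2 : HasDerivAt (fun ζ : ℂ => 1 - ζ) (-1) ζ := by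
      simpa using (hasDerivAt_id ζ).const_sub 1
    convert! h1.div h2 (hne ζ hζ) using 1
    ring
  have him : ∀ ζ ∈ Metric.ball (0 : ℂ) 1, 0 < (c ζ).im := by
    intro ζ hζ
    have h1 : 0 < Complex.normSq (1 - ζ) := Complex.normSq_pos.2 (hne ζ hζ)
    have h2 : Complex.normSq ζ < 1 := by
      rw [Complex.normSq_eq_norm_sq]
      have := mem_ball_zero_iff.1 hζ
      nlinarith [norm_nonneg ζ]
    have h3 : (c ζ).im = (1 - Complex.normSq ζ) / Complex.normSq (1 - ζ) := by
      simp only [c, Complex.div_im]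
      rw [Complex.normSq_apply ζ]
      simp
      ring
    rw [h3]
    exact div_pos (by linarith) h1
  obtain ⟨Ψ, hΨ⟩ : Complex.IsExactOn (fun ζ => f (c ζ) * (2 * Complex.I / (1 - ζ) ^ 2))
      (Metric.ball 0 1) := by
    refine DifferentiableOn.isExactOn_ball fun ζ hζ => ?_
    refine DifferentiableAt.differentiableWithinAt ?_
    refine ((hf _ (him ζ hζ)).comp ζ (hc ζ hζ).differentiableAt).mul ?_
    exact (differentiableAt_const _).div ((differentiableAt_id.const_sub 1).pow 2)
      (pow_ne_zero 2 (hne ζ hζ))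
  refine ⟨fun z => Ψ ((z - Complex.I) / (z + Complex.I)), fun z hz => ?_⟩
  have hzI : z + Complex.I ≠ 0 := by
    intro h
    have := congrArg Complex.im h
    simp at this
    linarith
  have hmem : (z - Complex.I) / (z + Complex.I) ∈ Metric.ball (0 : ℂ) 1 := by
    rw [mem_ball_zero_iff, norm_div, div_lt_one (norm_pos_iff.2 hzI)]
    rw [← sq_lt_sq₀ (norm_nonneg _) (norm_nonneg _), ← Complex.normSq_eq_norm_sq,
      ← Complex.normSq_eq_norm_sq, Complex.normSq_apply, Complex.normSq_apply]
    simp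
    nlinarith
  have hm : HasDerivAt (fun z : ℂ => (z - Complex.I) / (z + Complex.I))
      (2 * Complex.I / (z + Complex.I) ^ 2) z := by
    convert! ((hasDerivAt_id z).sub_const Complex.I).div ((hasDerivAt_id z).add_const Complex.I)
      hzI using 1
    simp
    ring
  have hone : 1 - (z - Complex.I) / (z + Complex.I) = 2 * Complex.I / (z + Complex.I) := by
    field_simp
    ring
  have hcz : c ((z - Complex.I) / (z + Complex.I)) = z := by
    simp only [c]
    rw [hone]
    field_simp
    ring
  have h := (hΨ _ hmem).comp z hm
  simp only [hcz, hone] at h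
  convert! h using 1
  field_simp

theorem exists_eq_add_const_of_hasDerivAt {s : Set ℂ} (hs : IsOpen s) (hconv : Convex ℝ s)
    {F Φ f : ℂ → ℂ} (hF : ∀ z ∈ s, HasDerivAt F (f z) z) (hΦ : ∀ z ∈ s, HasDerivAt Φ (f z) z) :
    ∃ k, ∀ z ∈ s, F z = Φ z + k := by
  obtain ⟨k, hk⟩ := hs.exists_is_const_of_deriv_eq_zero (f := fun z => F z - Φ z)
    hconv.isPreconnected
    (fun z hz => ((hF z hz).sub (hΦ z hz)).differentiableAt.differentiableWithinAt)
    (fun z hz => by simpa using! ((hF z hz).sub (hΦ z hz)).deriv)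
  exact ⟨k, fun z hz => by rw [← hk z hz]; ring⟩

theorem exists_ball_forall_ne {S : Finset ℝ} {x : ℝ} (hx : x ∉ S) :
    ∃ ε > 0, ∀ z ∈ Metric.ball (x : ℂ) ε, ∀ e ∈ S, z.re ≠ e := by
  have hopen : IsOpen {z : ℂ | z.re ∉ S} :=
    (S.finite_toSet.isClosed.isOpen_compl).preimage Complex.continuous_re
  obtain ⟨ε, hε, h⟩ := Metric.isOpen_iff.1 hopen (x : ℂ) (by simpa using hx)
  exact ⟨ε, hε, fun z hz e he heq => h hz (by rw [heq]; exact he)⟩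

theorem exists_local_primitive_branchQuot {n : ℂ → ℂ} (hn : Differentiable ℂ n) {S : Finset ℝ}
    {x : ℝ} (hx : x ∉ S) : ∃ ε > 0, ∃ Φ : ℂ → ℂ,
      ∀ z ∈ Metric.ball (x : ℂ) ε, HasDerivAt Φ (branchQuot n S z) z := by
  obtain ⟨ε, hε, h⟩ := exists_ball_forall_ne hx
  obtain ⟨Φ, hΦ⟩ := DifferentiableOn.isExactOn_ball (f := branchQuot n S) (c := (x : ℂ)) (r := ε)
    fun z hz => (differentiableAt_branchQuot hn fun e he => Or.inr (h z hz e he))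
      |>.differentiableWithinAt
  exact ⟨ε, hε, Φ, hΦ⟩

/-- Near a real point, `branchQuot n S` has a primitive in the upper half-plane that is continuous
up to the real line, also when that point is a branch point. -/
theorem exists_continuous_primitive_branchQuot {n : ℂ → ℂ} (hn : Differentiable ℂ n)
    (S : Finset ℝ) (x : ℝ) : ∃ ε > 0, ∃ Φ : ℂ → ℂ,
      (∀ z ∈ Metric.ball (x : ℂ) ε, 0 ≤ z.im → ContinuousAt Φ z) ∧
      ∀ z ∈ Metric.ball (x : ℂ) ε, 0 < z.im → HasDerivAt Φ (branchQuot n S z) z := by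
  by_cases hx : x ∈ S
  · obtain ⟨ε, hε, h⟩ := exists_ball_forall_ne (Finset.notMem_erase x S)
    have hmem : ∀ ζ ∈ Metric.ball (0 : ℂ) (√ε), (x : ℂ) + ζ ^ 2 ∈ Metric.ball (x : ℂ) ε := by
      intro ζ hζ
      rw [mem_ball_zero_iff, Real.lt_sqrt (norm_nonneg _)] at hζ
      simpa using hζ
    -- With $z=x+\zeta^2$ one has $dz=2\zeta\,d\zeta$, and the factor $\zeta$ cancels the branch
    -- factor $\sqrt{z-x}$. The pulled-back form is therefore holomorphic at $\zeta=0$.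
    obtain ⟨Ψ, hΨ⟩ := DifferentiableOn.isExactOn_ball
      (f := fun ζ : ℂ => 2 * branchQuot n (S.erase x) (x + ζ ^ 2)) (c := 0) (r := √ε) (by
        intro ζ hζ
        refine DifferentiableAt.differentiableWithinAt (DifferentiableAt.const_mul ?_ _)
        refine DifferentiableAt.comp (f := fun ζ : ℂ => (x : ℂ) + ζ ^ 2) ζ
          (differentiableAt_branchQuot hn fun e he => Or.inr (h _ (hmem ζ hζ) e he)) ?_
        fun_prop)
    have hball : ∀ z ∈ Metric.ball (x : ℂ) ε,
        upperSqrt (z - x) ∈ Metric.ball (0 : ℂ) (√ε) := by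
      intro z hz
      rw [mem_ball_zero_iff, norm_upperSqrt]
      exact Real.sqrt_lt_sqrt (norm_nonneg _) (by simpa [dist_eq_norm] using hz)
    refine ⟨ε, hε, fun z => Ψ (upperSqrt (z - x)), fun z hz him => ?_, fun z hz him => ?_⟩
    · have h1 : ContinuousAt (fun w : ℂ => upperSqrt (w - x)) z :=
        ContinuousAt.comp (f := fun w : ℂ => w - (x : ℂ)) (continuousAt_upperSqrt (by simpa))
          (by fun_prop)
      exact ContinuousAt.comp (f := fun w : ℂ => upperSqrt (w - x))
        (hΨ _ (hball z hz)).continuousAt h1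
    · have h1 : HasDerivAt (fun w : ℂ => upperSqrt (w - x)) (1 / (2 * upperSqrt (z - x))) z :=
        HasDerivAt.comp_sub_const z (x : ℂ) (hasDerivAt_upperSqrt (Or.inl (by simpa)))
      have h2 := (hΨ _ (hball z hz)).comp z h1
      convert! h2 using 1
      have hne : upperSqrt (z - x) ≠ 0 := upperSqrt_ne_zero (by
        intro h0
        rw [sub_eq_zero] at h0
        simp [h0] at him)
      have hz2 : (x : ℂ) + upperSqrt (z - x) ^ 2 = z := by
        rw [upperSqrt_sq]; ring
      simp only [hz2, branchQuot]
      rw [← Finset.mul_prod_erase S _ hx]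
      by_cases hp : ∏ e ∈ S.erase x, upperSqrt (z - e) = 0
      · simp [hp]
      field_simp
  · obtain ⟨ε, hε, Φ, hΦ⟩ := exists_local_primitive_branchQuot hn hx
    exact ⟨ε, hε, Φ, fun z hz _ => (hΦ z hz).continuousAt, fun z hz _ => hΦ z hz⟩

theorem convex_ball_inter_upperHalfPlane (x : ℂ) (ε : ℝ) :
    Convex ℝ (Metric.ball x ε ∩ {z : ℂ | 0 < z.im}) :=
  (convex_ball x ε).inter (convex_halfSpace_im_gt 0)

theorem isOpen_ball_inter_upperHalfPlane (x : ℂ) (ε : ℝ) :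
    IsOpen (Metric.ball x ε ∩ {z : ℂ | 0 < z.im}) :=
  Metric.isOpen_ball.inter (isOpen_lt continuous_const Complex.continuous_im)

/-- A primitive of `branchQuot n S` on the upper half-plane, continuous up to the real line. -/
theorem exists_primitive_branchQuot {n : ℂ → ℂ} (hn : Differentiable ℂ n) (S : Finset ℝ) :
    ∃ F : ℂ → ℂ, ContinuousOn F {z : ℂ | 0 ≤ z.im} ∧
      ∀ z : ℂ, 0 < z.im → HasDerivAt F (branchQuot n S z) z := by
  obtain ⟨F, hF⟩ := exists_primitive_of_differentiableOn_upperHalfPlane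
    (f := branchQuot n S) fun z hz => differentiableAt_branchQuot hn fun e _ => Or.inl hz
  set U : Set ℂ := {z : ℂ | 0 < z.im}
  have hU : IsOpen U := isOpen_lt continuous_const Complex.continuous_im
  have hcont : ContinuousOn F U := fun z hz => (hF z hz).continuousAt.continuousWithinAt
  refine ⟨extendFrom U F, ?_, fun z hz => ?_⟩
  · refine continuousOn_extendFrom (by rw [Complex.closure_setOfPred_lt_im]) fun z hz => ?_
    rcases (show 0 ≤ z.im from hz).eq_or_lt with h0 | hpos
    · have hzx : z = ((z.re : ℝ) : ℂ) := Complex.ext (by simp) (by simp [← h0])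
      obtain ⟨ε, hε, Φ, hΦ, hΦ'⟩ := exists_continuous_primitive_branchQuot hn S z.re
      rw [← hzx] at hΦ hΦ'
      obtain ⟨k, hk⟩ := exists_eq_add_const_of_hasDerivAt
        (isOpen_ball_inter_upperHalfPlane z ε) (convex_ball_inter_upperHalfPlane z ε)
        (fun w hw => hF w hw.2) (fun w hw => hΦ' w hw.1 hw.2)
      refine ⟨Φ z + k, ?_⟩
      have h1 : Tendsto (fun w => Φ w + k) (𝓝[U] z) (𝓝 (Φ z + k)) :=
        ((hΦ z (Metric.mem_ball_self hε) hz).tendsto.add_const k).mono_left nhdsWithin_le_nhds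
      refine h1.congr' ?_
      filter_upwards [self_mem_nhdsWithin, mem_nhdsWithin_of_mem_nhds (Metric.ball_mem_nhds z hε)]
        with w hw hw'
      exact (hk w ⟨hw', hw⟩).symm
    · exact ⟨F z, (hF z hpos).continuousAt.tendsto.mono_left nhdsWithin_le_nhds⟩
  · refine (hF z hz).congr_of_eventuallyEq ?_
    filter_upwards [hU.mem_nhds hz] with w hw
    exact extendFrom_eq (subset_closure hw)
      ((hF w hw).continuousAt.tendsto.mono_left nhdsWithin_le_nhds)

/-! ### Reflection across the real line. -/

open ComplexConjugate in
/-- A primitive on a disc centred at a real point of a function that is real on the real line has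
a real part symmetric under conjugation. -/
theorem re_conj_eq_re_of_hasDerivAt {Φ f : ℂ → ℂ} {x ε : ℝ} (hε : 0 < ε)
    (hΦ : ∀ z ∈ Metric.ball (x : ℂ) ε, HasDerivAt Φ (f z) z)
    (hreal : ∀ᶠ y : ℝ in 𝓝 x, (f y).im = 0) {z : ℂ} (hz : z ∈ Metric.ball (x : ℂ) ε) :
    (Φ (conj z)).re = (Φ z).re := by
  have hconj : ∀ w ∈ Metric.ball (x : ℂ) ε, conj w ∈ Metric.ball (x : ℂ) ε := by
    intro w hw
    rw [Metric.mem_ball, ← Complex.conj_ofReal x, Complex.dist_conj_conj]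
    exact hw
  have hfd : DifferentiableOn ℂ f (Metric.ball (x : ℂ) ε) :=
    Complex.IsExactOn.differentiableOn Metric.isOpen_ball ⟨Φ, hΦ⟩
  have hfd' : DifferentiableOn ℂ (conj ∘ f ∘ conj) (Metric.ball (x : ℂ) ε) := by
    intro w hw
    have h1 : DifferentiableAt ℂ f (conj w) :=
      hfd.differentiableAt (Metric.isOpen_ball.mem_nhds (hconj w hw))
    have := h1.hasDerivAt.conj_conj
    rw [Complex.conj_conj] at this
    exact this.differentiableAt.differentiableWithinAt
  -- Both sides are holomorphic and agree on real points near `x`, so the identity theorem applies.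
  have hfeq : EqOn f (conj ∘ f ∘ conj) (Metric.ball (x : ℂ) ε) := by
    refine (hfd.analyticOnNhd Metric.isOpen_ball).eqOn_of_preconnected_of_frequently_eq
      (hfd'.analyticOnNhd Metric.isOpen_ball) (convex_ball _ _).isPreconnected
      (Metric.mem_ball_self hε) ?_
    have hmap : Tendsto (fun y : ℝ => (y : ℂ)) (𝓝[≠] x) (𝓝[≠] (x : ℂ)) := by
      refine tendsto_nhdsWithin_iff.2 ⟨?_, ?_⟩
      · exact (Complex.continuous_ofReal.tendsto x).mono_left nhdsWithin_le_nhds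
      · filter_upwards [self_mem_nhdsWithin] with y hy
        simpa using hy
    refine hmap.frequently (Eventually.frequently ?_)
    filter_upwards [hreal.filter_mono nhdsWithin_le_nhds] with y hy
    simp only [Function.comp, Complex.conj_ofReal]
    exact (Complex.conj_eq_iff_im.2 hy).symm
  have hΦ' : ∀ w ∈ Metric.ball (x : ℂ) ε, HasDerivAt (conj ∘ Φ ∘ conj) (f w) w := by
    intro w hw
    have := (hΦ _ (hconj w hw)).conj_conj
    rw [Complex.conj_conj] at this
    convert! this using 1
    exact hfeq hw
  obtain ⟨k, hk⟩ := exists_eq_add_const_of_hasDerivAt Metric.isOpen_ball (convex_ball _ _) hΦ hΦ'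
  have hx := congrArg Complex.re (hk x (Metric.mem_ball_self hε))
  have hz' := congrArg Complex.re (hk z hz)
  simp at hx hz'
  rw [hz', hx, add_zero]

section Reflection

variable {n : ℂ → ℂ} {S : Finset ℝ} {F : ℂ → ℂ}

/-- Away from the branch points, the primitive on the half-disc continues to the full disc: it
differs from a local primitive by a constant in the open half-disc, and continuity carries the
equality to the diameter. -/
theorem exists_local_extension (hn : Differentiable ℂ n)
    (hFc : ContinuousOn F {z : ℂ | 0 ≤ z.im})
    (hF : ∀ z : ℂ, 0 < z.im → HasDerivAt F (branchQuot n S z) z) {x : ℝ} (hx : x ∉ S) :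
    ∃ ε > 0, ∃ Φ : ℂ → ℂ, (∀ z ∈ Metric.ball (x : ℂ) ε, HasDerivAt Φ (branchQuot n S z) z) ∧
      ∀ z ∈ Metric.ball (x : ℂ) ε, 0 ≤ z.im → F z = Φ z := by
  obtain ⟨ε, hε, Φ, hΦ⟩ := exists_local_primitive_branchQuot hn hx
  obtain ⟨k, hk⟩ := exists_eq_add_const_of_hasDerivAt
    (isOpen_ball_inter_upperHalfPlane x ε) (convex_ball_inter_upperHalfPlane x ε)
    (fun w hw => hF w hw.2) (fun w hw => hΦ w hw.1)
  refine ⟨ε, hε, fun z => Φ z + k, fun z hz => (hΦ z hz).add_const k, fun z hz him => ?_⟩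
  have hcl : z ∈ closure {z : ℂ | 0 < z.im} := by
    rw [Complex.closure_setOfPred_lt_im]
    exact him
  have : (𝓝[{z : ℂ | 0 < z.im}] z).NeBot := mem_closure_iff_nhdsWithin_neBot.1 hcl
  have h1 : Tendsto F (𝓝[{z : ℂ | 0 < z.im}] z) (𝓝 (F z)) :=
    (hFc z him).mono_left (nhdsWithin_mono _ fun w (hw : 0 < w.im) => (show 0 ≤ w.im from hw.le))
  have h2 : Tendsto (fun w => Φ w + k) (𝓝[{z : ℂ | 0 < z.im}] z) (𝓝 (Φ z + k)) :=
    ((hΦ z hz).continuousAt.tendsto.add_const k).mono_left nhdsWithin_le_nhds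
  refine tendsto_nhds_unique_of_eventuallyEq h1 h2 ?_
  filter_upwards [self_mem_nhdsWithin,
    mem_nhdsWithin_of_mem_nhds (Metric.isOpen_ball.mem_nhds hz)] with w hw hw'
  exact hk w ⟨hw', hw⟩

/-- The even extension across the real line of the real part of `F`. -/
noncomputable def reflectRe (F : ℂ → ℂ) (z : ℂ) : ℝ := (F ⟨z.re, |z.im|⟩).re

theorem reflectRe_of_nonneg {z : ℂ} (hz : 0 ≤ z.im) : reflectRe F z = (F z).re := by
  rw [reflectRe, abs_of_nonneg hz]

open ComplexConjugate in
theorem reflectRe_of_nonpos {z : ℂ} (hz : z.im ≤ 0) : reflectRe F z = (F (conj z)).re := by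
  rw [reflectRe, abs_of_nonpos hz]
  rfl

theorem reflectRe_ofReal (x : ℝ) : reflectRe F x = (F x).re :=
  reflectRe_of_nonneg (by simp)

theorem continuous_reflectRe (hFc : ContinuousOn F {z : ℂ | 0 ≤ z.im}) :
    Continuous (reflectRe F) := by
  have hfold : Continuous fun z : ℂ => (⟨z.re, |z.im|⟩ : ℂ) := by
    have : (fun z : ℂ => (⟨z.re, |z.im|⟩ : ℂ)) =
        fun z : ℂ => (z.re : ℂ) + (|z.im| : ℝ) * Complex.I := by
      funext z
      apply Complex.ext <;> simp
    rw [this]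
    fun_prop
  exact Complex.continuous_re.comp
    (hFc.comp_continuous hfold fun z => show 0 ≤ |z.im| from abs_nonneg z.im)

theorem hasDerivAt_re_ofReal (hn : Differentiable ℂ n)
    (hFc : ContinuousOn F {z : ℂ | 0 ≤ z.im})
    (hF : ∀ z : ℂ, 0 < z.im → HasDerivAt F (branchQuot n S z) z) {x : ℝ} (hx : x ∉ S) :
    HasDerivAt (fun y : ℝ => (F y).re) (branchQuot n S x).re x := by
  obtain ⟨ε, hε, Φ, hΦ, hFΦ⟩ := exists_local_extension hn hFc hF hx
  refine (hΦ x (Metric.mem_ball_self hε)).real_of_complex.congr_of_eventuallyEq ?_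
  have : ∀ᶠ y : ℝ in 𝓝 x, (y : ℂ) ∈ Metric.ball (x : ℂ) ε :=
    Complex.continuous_ofReal.continuousAt.eventually (Metric.ball_mem_nhds _ hε)
  filter_upwards [this] with y hy
  rw [hFΦ y hy (by simp)]

open ComplexConjugate in
-- Schwarz reflection. At a real point outside `S` near which the derivative is real, the continued
-- primitive has a real part invariant under conjugation, so the even extension is locally the real
-- part of a holomorphic function.
theorem harmonicAt_reflectRe (hn : Differentiable ℂ n)
    (hFc : ContinuousOn F {z : ℂ | 0 ≤ z.im})
    (hF : ∀ z : ℂ, 0 < z.im → HasDerivAt F (branchQuot n S z) z) {z : ℂ}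
    (hz : z.im = 0 → z.re ∉ S ∧ ∀ᶠ y : ℝ in 𝓝 z.re, (branchQuot n S y).im = 0) :
    InnerProductSpace.HarmonicAt (reflectRe F) z := by
  have hFan : ∀ w : ℂ, 0 < w.im → AnalyticAt ℂ F w := by
    intro w hw
    have hU : {w : ℂ | 0 < w.im} ∈ 𝓝 w :=
      (isOpen_lt continuous_const Complex.continuous_im).mem_nhds hw
    exact DifferentiableOn.analyticAt
      (fun y hy => (hF y hy).differentiableAt.differentiableWithinAt) hU
  rcases lt_trichotomy z.im 0 with hneg | hzero | hpos
  · have hU : {w : ℂ | w.im < 0} ∈ 𝓝 z :=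
      (isOpen_lt Complex.continuous_im continuous_const).mem_nhds hneg
    have han : AnalyticAt ℂ (conj ∘ F ∘ conj) z := by
      refine DifferentiableOn.analyticAt (s := {w : ℂ | w.im < 0}) (fun w hw => ?_) hU
      have := (hF (conj w) (by simpa using hw)).conj_conj
      rw [Complex.conj_conj] at this
      exact this.differentiableAt.differentiableWithinAt
    refine (InnerProductSpace.harmonicAt_congr_nhds ?_).2 han.harmonicAt_re
    filter_upwards [hU] with w hw
    rw [reflectRe_of_nonpos (le_of_lt hw)]
    simp
  · obtain ⟨hS, hreal⟩ := hz hzero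
    have hzx : ((z.re : ℝ) : ℂ) = z := Complex.ext (by simp) (by simp [hzero])
    obtain ⟨ε, hε, Φ, hΦ, hFΦ⟩ := exists_local_extension hn hFc hF hS
    have hball : Metric.ball ((z.re : ℝ) : ℂ) ε ∈ 𝓝 z := by
      rw [hzx]
      exact Metric.ball_mem_nhds z hε
    have han : AnalyticAt ℂ Φ z := DifferentiableOn.analyticAt
      (fun w hw => (hΦ w hw).differentiableAt.differentiableWithinAt) hball
    refine (InnerProductSpace.harmonicAt_congr_nhds ?_).2 han.harmonicAt_re
    filter_upwards [hball] with w hw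
    rcases le_total 0 w.im with him | him
    · rw [reflectRe_of_nonneg him, hFΦ w hw him]
    · have hw' : conj w ∈ Metric.ball ((z.re : ℝ) : ℂ) ε := by
        rw [Metric.mem_ball, ← Complex.conj_ofReal z.re, Complex.dist_conj_conj]
        exact hw
      rw [reflectRe_of_nonpos him, hFΦ _ hw' (by simpa using him)]
      exact re_conj_eq_re_of_hasDerivAt hε hΦ hreal hw
  · refine (InnerProductSpace.harmonicAt_congr_nhds ?_).2 (hFan z hpos).harmonicAt_re
    filter_upwards [(isOpen_lt continuous_const Complex.continuous_im).mem_nhds hpos] with w hw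
    exact reflectRe_of_nonneg (le_of_lt hw)

end Reflection

/-! ### Behaviour at infinity and construction of Green functions. -/

/-- If the derivative of `F` is `1 / z + O(1 / z ^ 2)` in the upper half-plane, then `Re F` is `log |z| + O(1)`. -/
theorem exists_abs_re_sub_log_le {F f : ℂ → ℂ}
    (hF : ∀ z : ℂ, 0 < z.im → HasDerivAt F (f z) z) {C R : ℝ} (hR : 0 < R)
    (hf : ∀ z : ℂ, 0 < z.im → R < ‖z‖ → ‖f z - z⁻¹‖ * ‖z‖ ^ 2 ≤ C) :
    ∃ M, ∀ z : ℂ, 0 < z.im → R < ‖z‖ → |(F z).re - Real.log ‖z‖| ≤ M := by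
  set W : Set ℂ := Metric.ball (0 : ℂ) R⁻¹ ∩ {z : ℂ | 0 < z.im}
  have hne : ∀ w ∈ W, w ≠ 0 := by
    rintro w hw rfl
    simpa using hw.2
  have him : ∀ w : ℂ, 0 < w.im → 0 < (-w⁻¹).im := by
    intro w hw
    have h0 : 0 < Complex.normSq w := Complex.normSq_pos.2 (by rintro rfl; simp at hw)
    simp only [Complex.neg_im, Complex.inv_im, neg_div, neg_neg]
    exact div_pos hw h0
  have hnorm : ∀ w ∈ W, R < ‖-w⁻¹‖ := by
    intro w hw
    rw [norm_neg, norm_inv]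
    exact (lt_inv_comm₀ hR (norm_pos_iff.2 (hne w hw))).2 (mem_ball_zero_iff.1 hw.1)
  -- In the coordinate $w=-1/z$, which preserves the upper half-plane, a neighbourhood of infinity
  -- becomes a convex half-disc. There $F-\log$ has derivative bounded by `C`, and the mean value
  -- inequality bounds it.
  set D : ℂ → ℂ := fun w => F (-w⁻¹) - Complex.log (-w⁻¹)
  have hD : ∀ w ∈ W, HasDerivAt D ((f (-w⁻¹) - (-w⁻¹)⁻¹) * (w ^ 2)⁻¹) w := by
    intro w hw
    have hi : HasDerivAt (fun w : ℂ => -w⁻¹) ((w ^ 2)⁻¹) w := by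
      simpa using! (hasDerivAt_inv (hne w hw)).neg
    have h1 := (hF _ (him w hw.2)).comp w hi
    have h2 := (Complex.hasDerivAt_log (Or.inr (him w hw.2).ne')).comp w hi
    convert! h1.sub h2 using 1
    ring
  have hbound : ∀ w ∈ W, ‖(f (-w⁻¹) - (-w⁻¹)⁻¹) * (w ^ 2)⁻¹‖ ≤ C := by
    intro w hw
    convert hf (-w⁻¹) (him w hw.2) (hnorm w hw) using 1
    simp
  have hconv : Convex ℝ W := convex_ball_inter_upperHalfPlane 0 R⁻¹
  set w₀ : ℂ := ((R⁻¹ / 2 : ℝ) : ℂ) * Complex.I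
  have hR' : 0 < R⁻¹ := inv_pos.2 hR
  have hw₀ : w₀ ∈ W := by
    refine ⟨?_, ?_⟩
    · rw [mem_ball_zero_iff, norm_mul, Complex.norm_I, mul_one, Complex.norm_real,
        Real.norm_of_nonneg (by positivity)]
      linarith
    · have : w₀.im = R⁻¹ / 2 := by simp only [w₀, Complex.im_ofReal_mul, Complex.I_im, mul_one]
      simp only [mem_ofPred_eq, this]
      positivity
  have hC : 0 ≤ C := (norm_nonneg _).trans (hbound w₀ hw₀)
  refine ⟨C * (2 * R⁻¹) + ‖D w₀‖, fun z hz hzR => ?_⟩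
  have hz0 : z ≠ 0 := by rintro rfl; simp at hz
  have hw : -z⁻¹ ∈ W := by
    refine ⟨?_, him z hz⟩
    rw [mem_ball_zero_iff, norm_neg, norm_inv]
    exact inv_strictAnti₀ hR hzR
  have hDz : D (-z⁻¹) = F z - Complex.log z := by
    simp [D]
  have h1 := Convex.norm_image_sub_le_of_norm_hasDerivWithin_le
    (fun w hw => (hD w hw).hasDerivWithinAt) hbound hconv hw₀ hw
  have h2 : ‖-z⁻¹ - w₀‖ ≤ 2 * R⁻¹ := by
    refine (norm_sub_le _ _).trans ?_
    have := mem_ball_zero_iff.1 hw.1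
    have := mem_ball_zero_iff.1 hw₀.1
    linarith
  have h3 : |(F z).re - Real.log ‖z‖| ≤ ‖D (-z⁻¹)‖ := by
    rw [hDz]
    have := Complex.abs_re_le_norm (F z - Complex.log z)
    rwa [Complex.sub_re, Complex.log_re] at this
  calc |(F z).re - Real.log ‖z‖| ≤ ‖D (-z⁻¹)‖ := h3
    _ = ‖(D (-z⁻¹) - D w₀) + D w₀‖ := by rw [sub_add_cancel]
    _ ≤ ‖D (-z⁻¹) - D w₀‖ + ‖D w₀‖ := norm_add_le _ _
    _ ≤ _ := by
      have := h1.trans (mul_le_mul_of_nonneg_left h2 hC)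
      linarith

theorem reflectRe_sub_log_isBigO {F f : ℂ → ℂ} (hFc : ContinuousOn F {z : ℂ | 0 ≤ z.im})
    (hF : ∀ z : ℂ, 0 < z.im → HasDerivAt F (f z) z) {C R : ℝ} (hR : 0 < R)
    (hf : ∀ z : ℂ, 0 < z.im → R < ‖z‖ → ‖f z - z⁻¹‖ * ‖z‖ ^ 2 ≤ C) :
    (fun z : ℂ => reflectRe F z - Real.log ‖z‖) =O[Bornology.cobounded ℂ]
      (fun _ => (1 : ℝ)) := by
  obtain ⟨M, hM⟩ := exists_abs_re_sub_log_le hF hR hf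
  have hnonneg : ∀ z : ℂ, 0 ≤ z.im → R < ‖z‖ → |(F z).re - Real.log ‖z‖| ≤ M := by
    intro z hz hzR
    have hcl : z ∈ closure {z : ℂ | 0 < z.im} := by
      rw [Complex.closure_setOfPred_lt_im]
      exact hz
    have : (𝓝[{z : ℂ | 0 < z.im}] z).NeBot := mem_closure_iff_nhdsWithin_neBot.1 hcl
    have h1 : Tendsto F (𝓝[{z : ℂ | 0 < z.im}] z) (𝓝 (F z)) :=
      (hFc z hz).mono_left (nhdsWithin_mono _ fun w (hw : 0 < w.im) => (show 0 ≤ w.im from hw.le))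
    have h2 : Tendsto (fun z : ℂ => Real.log ‖z‖) (𝓝[{z : ℂ | 0 < z.im}] z)
        (𝓝 (Real.log ‖z‖)) := by
      refine Tendsto.mono_left ?_ nhdsWithin_le_nhds
      exact (continuous_norm.tendsto z).log (hR.trans hzR).ne'
    have h3 := (((Complex.continuous_re.tendsto _).comp h1).sub h2).abs
    refine le_of_tendsto h3 ?_
    filter_upwards [self_mem_nhdsWithin, mem_nhdsWithin_of_mem_nhds
      ((isOpen_lt continuous_const continuous_norm).mem_nhds hzR)] with w hw hw'
    exact hM w hw hw'
  refine Asymptotics.IsBigO.of_bound M ?_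
  filter_upwards [tendsto_norm_cobounded_atTop.eventually (eventually_gt_atTop R)] with z hz
  have hnorm : ‖(⟨z.re, |z.im|⟩ : ℂ)‖ = ‖z‖ := by
    rw [Complex.norm_def, Complex.norm_def, Complex.normSq_apply, Complex.normSq_apply]
    simp
  have := hnonneg ⟨z.re, |z.im|⟩ (abs_nonneg _) (by rwa [hnorm])
  rw [hnorm] at this
  simpa [reflectRe] using this

/-- Construction of a Green function from its complex derivative `branchQuot n S`. -/
theorem exists_isGreenAtInfty {n : ℂ → ℂ} (hn : Differentiable ℂ n) {S : Finset ℝ} {A : Set ℝ}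
    (hA : IsClosed A) (hA0 : A.Nonempty) (hSA : ∀ e ∈ S, e ∈ A) {p q : ℝ} (hApq : A ⊆ Icc p q)
    (hreal : ∀ x ∉ A, (branchQuot n S x).im = 0) {u : ℝ → ℝ} (hu : ContinuousOn u (Icc p q))
    (hu' : ∀ x ∈ Ioo p q, x ∉ S → HasDerivAt u (branchQuot n S x).re x)
    (hu0 : ∀ x ∈ A, u x = 0) {C R : ℝ} (hR : 0 < R)
    (hf : ∀ z : ℂ, 0 < z.im → R < ‖z‖ → ‖branchQuot n S z - z⁻¹‖ * ‖z‖ ^ 2 ≤ C) :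
    ∃ g : ℂ → ℝ, IsGreenAtInfty ((fun t : ℝ => (t : ℂ)) '' A) g ∧ ∀ x ∈ Icc p q, g x = u x := by
  obtain ⟨F, hFc, hF⟩ := exists_primitive_branchQuot hn S
  obtain ⟨a, ha⟩ := hA0
  have hcont : Continuous (reflectRe F) := continuous_reflectRe hFc
  have hreC : Continuous fun y : ℝ => (F y).re := by
    have h := hcont.comp Complex.continuous_ofReal
    refine h.congr fun y => ?_
    exact reflectRe_ofReal y
  have hpq : p ≤ q := (hApq ha).1.trans (hApq ha).2
  -- `u` and $\operatorname{Re}F$ are continuous and have equal derivatives off the finite set `S`,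
  -- so they differ by a constant even across the branch points.
  have hconst : ∀ x ∈ Icc p q, (F x).re - u x = (F p).re - u p := by
    intro x hx
    have h := MeasureTheory.integral_eq_of_hasDerivAt_off_countable_of_le
      (fun y : ℝ => (F y).re - u y) (fun _ => 0) hx.1 S.countable_toSet
      (hreC.continuousOn.sub (hu.mono (Icc_subset_Icc_right hx.2)))
      (fun y hy => by
        have h1 := hasDerivAt_re_ofReal hn hFc hF (x := y) hy.2
        have h2 := hu' y ⟨hy.1.1, hy.1.2.trans_le hx.2⟩ hy.2
        simpa using! h1.sub h2) (by simp)
    simp at h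
    linarith
  set k := (F p).re - u p
  have hgu : ∀ x ∈ Icc p q, reflectRe F x - k = u x := by
    intro x hx
    rw [reflectRe_ofReal, ← hconst x hx]
    ring
  refine ⟨fun z => reflectRe F z - k, ⟨?_, hcont.sub continuous_const, ?_, ?_⟩, hgu⟩
  · refine InnerProductSpace.HarmonicOnNhd.sub (fun z hz => ?_)
      (InnerProductSpace.harmonicOnNhd_const k)
    refine harmonicAt_reflectRe hn hFc hF fun h0 => ?_
    have hzA : z.re ∉ A := fun h => hz ⟨z.re, h, Complex.ext (by simp) (by simp [h0])⟩
    refine ⟨fun h => hzA (hSA _ h), ?_⟩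
    filter_upwards [hA.isOpen_compl.mem_nhds hzA] with y hy
    exact hreal y hy
  · rintro _ ⟨x, hx, rfl⟩
    exact (hgu x (hApq hx)).trans (hu0 x hx)
  · have h1 := reflectRe_sub_log_isBigO hFc hF hR hf
    have h2 : (fun _ : ℂ => k) =O[Bornology.cobounded ℂ] (fun _ => (1 : ℝ)) :=
      Asymptotics.isBigO_const_const _ one_ne_zero _
    refine (h1.sub h2).congr_left fun z => ?_
    ring

/-- The neighbourhoods of infinity in the upper half-plane. -/
noncomputable def upperInfty : Filter ℂ := Bornology.cobounded ℂ ⊓ 𝓟 {z : ℂ | 0 < z.im}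

theorem eventually_upperInfty_im_pos : ∀ᶠ z in upperInfty, 0 < z.im :=
  mem_inf_of_right (mem_principal_self _)

theorem eventually_upperInfty_ne_zero : ∀ᶠ z in upperInfty, z ≠ 0 :=
  eventually_upperInfty_im_pos.mono fun z hz h => by simp [h] at hz

theorem tendsto_inv_upperInfty : Tendsto (fun z : ℂ => z⁻¹) upperInfty (𝓝 0) :=
  tendsto_inv₀_cobounded.mono_left inf_le_left

theorem exists_forall_of_eventually_upperInfty {P : ℂ → Prop} (h : ∀ᶠ z in upperInfty, P z) :
    ∃ R > 0, ∀ z : ℂ, 0 < z.im → R < ‖z‖ → P z := by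
  rw [upperInfty, eventually_inf_principal] at h
  obtain ⟨R, -, hR⟩ := (hasBasis_cobounded_norm (E := ℂ)).eventually_iff.1 h
  refine ⟨max R 1, by positivity, fun z hz hzR => hR ?_ hz⟩
  exact (le_max_left R 1).trans hzR.le

/-- The quotient $\rho$ satisfies $(\rho-1)(\rho+1)=-e/z$. Both roots lie in the open first
quadrant, so $\operatorname{Re}\rho>0$ and $|\rho+1|\ge1$. -/
theorem upperSqrt_div_sub_one_isBigO (e : ℝ) :
    (fun z : ℂ => upperSqrt (z - e) / upperSqrt z - 1) =O[upperInfty] fun z => z⁻¹ := by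
  refine Asymptotics.IsBigO.of_bound |e| ?_
  filter_upwards [eventually_upperInfty_im_pos] with z hz
  have hz0 : z ≠ 0 := by rintro rfl; simp at hz
  obtain ⟨h1, h2⟩ := upperSqrt_re_pos_im_pos hz
  obtain ⟨h3, h4⟩ := upperSqrt_re_pos_im_pos (z := z - e) (by simpa using hz)
  set ρ := upperSqrt (z - e) / upperSqrt z with hρ
  have hre : 0 < ρ.re := by
    rw [hρ, Complex.div_re]
    have : 0 < Complex.normSq (upperSqrt z) := Complex.normSq_pos.2 (upperSqrt_ne_zero hz0)
    positivity
  have hsq : (ρ - 1) * (ρ + 1) = -e * z⁻¹ := by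
    have : ρ ^ 2 = (z - e) / z := by rw [hρ, div_pow, upperSqrt_sq, upperSqrt_sq]
    have h5 : (ρ - 1) * (ρ + 1) = ρ ^ 2 - 1 := by ring
    rw [h5, this]
    field_simp
    ring
  have hone : 1 ≤ ‖ρ + 1‖ := by
    have := Complex.re_le_norm (ρ + 1)
    simp at this
    linarith
  calc ‖ρ - 1‖ ≤ ‖ρ - 1‖ * ‖ρ + 1‖ := le_mul_of_one_le_right (norm_nonneg _) hone
    _ = |e| * ‖z⁻¹‖ := by rw [← norm_mul, hsq, norm_mul, norm_neg, Complex.norm_real,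
      Real.norm_eq_abs]

theorem prod_upperSqrt_div_sub_one_isBigO (S : Finset ℝ) :
    (fun z : ℂ => ∏ e ∈ S, (upperSqrt (z - e) / upperSqrt z) - 1) =O[upperInfty]
      fun z => z⁻¹ := by
  classical
  induction S using Finset.induction_on with
  | empty => simpa using Asymptotics.isBigO_zero _ _
  | insert e S he ih =>
    have h1 := upperSqrt_div_sub_one_isBigO e
    have h2 : (fun z : ℂ => (∏ e ∈ S, (upperSqrt (z - e) / upperSqrt z) - 1) *
        (upperSqrt (z - e) / upperSqrt z - 1)) =O[upperInfty] fun z => z⁻¹ := by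
      have h3 : (fun z : ℂ => upperSqrt (z - e) / upperSqrt z - 1) =O[upperInfty]
          fun _ => (1 : ℂ) :=
        h1.trans (tendsto_inv_upperInfty.isBigO_one ℂ)
      simpa using ih.mul h3
    refine ((h2.add ih).add h1).congr_left fun z => ?_
    rw [Finset.prod_insert he]
    ring

/-- If `n` is asymptotically monic of half the degree of the radicand minus one, then
`branchQuot n S` is `1 / z + O(1 / z ^ 2)`. -/
theorem exists_norm_branchQuot_sub_inv_le {n : ℂ → ℂ} {S : Finset ℝ} {m : ℕ}
    (hcard : S.card = 2 * m)
    (hn : (fun z : ℂ => n z * z / z ^ m - 1) =O[upperInfty] fun z => z⁻¹) :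
    ∃ C : ℝ, ∃ R > 0, ∀ z : ℂ, 0 < z.im → R < ‖z‖ →
      ‖branchQuot n S z - z⁻¹‖ * ‖z‖ ^ 2 ≤ C := by
  set P : ℂ → ℂ := fun z => ∏ e ∈ S, (upperSqrt (z - e) / upperSqrt z) with hP
  have hP1 := prod_upperSqrt_div_sub_one_isBigO S
  have hlim : Tendsto P upperInfty (𝓝 1) := by
    have := (hP1.trans_tendsto tendsto_inv_upperInfty).add_const 1
    simpa only [sub_add_cancel, zero_add] using this
  have hinv : (fun z => (P z)⁻¹) =O[upperInfty] fun _ => (1 : ℂ) :=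
    (hlim.inv₀ one_ne_zero).isBigO_one ℂ
  have hmain : (fun z : ℂ => z * branchQuot n S z - 1) =O[upperInfty] fun z => z⁻¹ := by
    have h := (hn.sub hP1).mul hinv
    simp only [mul_one] at h
    refine h.congr' ?_ EventuallyEq.rfl
    filter_upwards [eventually_upperInfty_ne_zero,
      hlim.eventually (isOpen_ne.mem_nhds one_ne_zero)] with z hz hPz
    have hprod : ∏ e ∈ S, upperSqrt (z - e) = z ^ m * P z := by
      have hs := upperSqrt_ne_zero hz
      simp only [hP, Finset.prod_div_distrib, Finset.prod_const, hcard, pow_mul, upperSqrt_sq]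
      field_simp
    have hzm : z ^ m ≠ 0 := pow_ne_zero m hz
    rw [branchQuot, hprod]
    change (n z * z / z ^ m - 1 - (P z - 1)) * (P z)⁻¹ = _
    change P z ≠ 0 at hPz
    field_simp
    ring
  obtain ⟨C, hC⟩ := hmain.bound
  obtain ⟨R, hR, h⟩ := exists_forall_of_eventually_upperInfty
    (hC.and eventually_upperInfty_ne_zero)
  refine ⟨C, R, hR, fun z hz hzR => ?_⟩
  obtain ⟨h1, h2⟩ := h z hz hzR
  have hpos : 0 < ‖z‖ := norm_pos_iff.2 h2
  have h3 : ‖branchQuot n S z - z⁻¹‖ * ‖z‖ ^ 2 = ‖z * branchQuot n S z - 1‖ * ‖z‖ := by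
    rw [sq, ← mul_assoc, ← norm_mul]
    congr 2
    rw [sub_mul, inv_mul_cancel₀ h2, mul_comm]
  rw [h3]
  calc _ ≤ C * ‖z⁻¹‖ * ‖z‖ := mul_le_mul_of_nonneg_right h1 hpos.le
    _ = C := by rw [norm_inv, mul_assoc, inv_mul_cancel₀ hpos.ne', mul_one]

/-! ### Integrals with a parameter and a moving limit. -/

section ParametricIntegral

open MeasureTheory

variable {k k' : ℝ → ℝ → ℝ} {J : Set ℝ}

theorem continuous_section (hk : ContinuousOn (Function.uncurry k) (J ×ˢ univ)) {α : ℝ}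
    (hα : α ∈ J) : Continuous (k α) :=
  hk.comp_continuous (Continuous.prodMk_right α) fun _ => ⟨hα, mem_univ _⟩

theorem hasDerivAt_parametric_intervalIntegral (hJ : IsOpen J)
    (hk : ContinuousOn (Function.uncurry k) (J ×ˢ univ))
    (hk' : ContinuousOn (Function.uncurry k') (J ×ˢ univ))
    (hd : ∀ α ∈ J, ∀ φ, HasDerivAt (fun β => k β φ) (k' α φ) α) {α : ℝ} (hα : α ∈ J) (a b : ℝ) :
    HasDerivAt (fun β => ∫ φ in a..b, k β φ) (∫ φ in a..b, k' α φ) α := by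
  obtain ⟨r, hr, hrJ⟩ := Metric.nhds_basis_closedBall.mem_iff.1 (hJ.mem_nhds hα)
  obtain ⟨C, hC⟩ := ((isCompact_closedBall α r).prod (isCompact_uIcc (a := a) (b := b)))
    |>.exists_bound_of_continuousOn (hk'.mono (prod_mono hrJ (subset_univ _)))
  refine (intervalIntegral.hasDerivAt_integral_of_dominated_loc_of_deriv_le
    (F' := k') (bound := fun _ => C) (s := Metric.closedBall α r)
    (Metric.closedBall_mem_nhds α hr) ?_ ?_ ?_ ?_ ?_ ?_).2
  · filter_upwards [hJ.mem_nhds hα] with β hβ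
    exact (continuous_section hk hβ).aestronglyMeasurable
  · exact (continuous_section hk hα).intervalIntegrable _ _
  · exact (continuous_section hk' hα).aestronglyMeasurable
  · exact Eventually.of_forall fun φ hφ β hβ => hC (β, φ) ⟨hβ, uIoc_subset_uIcc hφ⟩
  · simp
  · exact Eventually.of_forall fun φ hφ β hβ => hd β (hrJ hβ) φ

/-- Leibniz rule for an integral whose integrand and lower limit depend on the parameter. -/
theorem hasDerivAt_intervalIntegral_moving (hJ : IsOpen J)
    (hk : ContinuousOn (Function.uncurry k) (J ×ˢ univ))
    (hk' : ContinuousOn (Function.uncurry k') (J ×ˢ univ))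
    (hd : ∀ α ∈ J, ∀ φ, HasDerivAt (fun β => k β φ) (k' α φ) α) {α : ℝ} (hα : α ∈ J)
    {θ : ℝ → ℝ} {θ' : ℝ} (hθ : HasDerivAt θ θ' α) (c : ℝ) :
    HasDerivAt (fun β => ∫ φ in θ β..c, k β φ)
      ((∫ φ in θ α..c, k' α φ) - k α (θ α) * θ') α := by
  -- The integral from `θ β` is the one from the fixed limit `θ α` minus this short piece, where
  -- continuity of `k` lets the integrand be replaced by its value at `(α, θ α)`.
  have hmove : HasDerivAt (fun β => ∫ φ in θ α..θ β, k β φ) (k α (θ α) * θ') α := by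
    have hlin : (fun β => k α (θ α) * (θ β - θ α - (β - α) * θ')) =o[𝓝 α] fun β => β - α := by
      have := hasDerivAt_iff_isLittleO.1 hθ
      simp only [smul_eq_mul] at this
      exact this.const_mul_left _
    have hbig : (fun β => θ β - θ α) =O[𝓝 α] fun β => β - α := hθ.isBigO_sub
    have hsmall : (fun β => ∫ φ in θ α..θ β, (k β φ - k α (θ α))) =o[𝓝 α]
        fun β => θ β - θ α := by
      rw [Asymptotics.isLittleO_iff]
      intro ε hε
      have hat : ContinuousAt (Function.uncurry k) (α, θ α) :=
        hk.continuousAt ((hJ.prod isOpen_univ).mem_nhds ⟨hα, mem_univ _⟩)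
      obtain ⟨η, hη, hclose⟩ := Metric.continuousAt_iff.1 hat ε hε
      have h1 : ∀ᶠ β in 𝓝 α, dist (θ β) (θ α) < η :=
        hθ.continuousAt.eventually (Metric.ball_mem_nhds _ hη)
      filter_upwards [h1, Metric.ball_mem_nhds α hη] with β hβ hβ'
      refine intervalIntegral.norm_integral_le_of_norm_le_const fun φ hφ => ?_
      have hφ' : dist φ (θ α) < η := by
        refine lt_of_le_of_lt ?_ hβ
        rw [Real.dist_eq, Real.dist_eq]
        exact abs_sub_left_of_mem_uIcc (uIoc_subset_uIcc hφ)
      exact (hclose (x := (β, φ)) (max_lt hβ' hφ')).le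
    rw [hasDerivAt_iff_isLittleO]
    refine ((hsmall.trans_isBigO hbig).add hlin).congr' ?_ EventuallyEq.rfl
    filter_upwards [hJ.mem_nhds hα] with β hβ
    rw [intervalIntegral.integral_sub ((continuous_section hk hβ).intervalIntegrable _ _)
      intervalIntegrable_const]
    simp
    ring
  have h := (hasDerivAt_parametric_intervalIntegral hJ hk hk' hd hα (θ α) c).sub hmove
  refine h.congr_of_eventuallyEq ?_
  filter_upwards [hJ.mem_nhds hα] with β hβ
  exact (intervalIntegral.integral_interval_sub_left
    ((continuous_section hk hβ).intervalIntegrable _ _)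
    ((continuous_section hk hβ).intervalIntegrable _ _)).symm

/-- Bounded convergence for an integral with a moving lower limit. -/
theorem tendsto_intervalIntegral_moving {l : Filter ℝ} [l.IsCountablyGenerated] {k₀ : ℝ → ℝ}
    {θ : ℝ → ℝ} {θ₀ a c M : ℝ} (hmeas : ∀ β, Measurable (k β)) (hθ : Tendsto θ l (𝓝 θ₀))
    (haθ : a < θ₀) (hθc : ∀ᶠ β in l, θ β ≤ c) (hc : θ₀ ≤ c)
    (hM : ∀ᶠ β in l, ∀ φ ∈ Icc a c, |k β φ| ≤ M)
    (hlim : ∀ φ ∈ Icc a c, Tendsto (fun β => k β φ) l (𝓝 (k₀ φ))) :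
    Tendsto (fun β => ∫ φ in θ β..c, k β φ) l (𝓝 (∫ φ in θ₀..c, k₀ φ)) := by
  have hfix : Tendsto (fun β => ∫ φ in θ₀..c, k β φ) l (𝓝 (∫ φ in θ₀..c, k₀ φ)) := by
    refine intervalIntegral.tendsto_integral_filter_of_dominated_convergence (fun _ => M) ?_ ?_
      (by simp) ?_
    · exact Eventually.of_forall fun β => (hmeas β).aestronglyMeasurable
    · filter_upwards [hM] with β hβ
      refine Eventually.of_forall fun φ hφ => hβ φ ?_
      rw [uIoc_of_le hc] at hφ
      exact ⟨haθ.le.trans hφ.1.le, hφ.2⟩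
    · refine Eventually.of_forall fun φ hφ => hlim φ ?_
      rw [uIoc_of_le hc] at hφ
      exact ⟨haθ.le.trans hφ.1.le, hφ.2⟩
  have hmove : Tendsto (fun β => ∫ φ in θ β..θ₀, k β φ) l (𝓝 0) := by
    have hz : Tendsto (fun β => M * |θ₀ - θ β|) l (𝓝 0) := by
      have := ((tendsto_const_nhds (x := θ₀)).sub hθ).abs.const_mul M
      simpa using this
    refine squeeze_zero_norm' ?_ hz
    filter_upwards [hM, hθc, hθ.eventually (lt_mem_nhds haθ)] with β hβ hβc hβa
    refine intervalIntegral.norm_integral_le_of_norm_le_const fun φ hφ => hβ φ ?_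
    have h1 := uIoc_subset_uIcc hφ
    exact (uIcc_subset_Icc ⟨hβa.le, hβc⟩ ⟨haθ.le, hc⟩) h1
  have := hmove.add hfix
  rw [zero_add] at this
  refine this.congr' ?_
  filter_upwards [hM, hθc, hθ.eventually (lt_mem_nhds haθ)] with β hβ hβc hβa
  have hint : ∀ s ∈ Icc a c, ∀ t ∈ Icc a c, IntervalIntegrable (k β) volume s t := by
    intro s hs t ht
    refine (intervalIntegrable_const (c := M)).mono_fun
      (hmeas β).aestronglyMeasurable ?_
    refine (ae_restrict_mem measurableSet_uIoc).mono fun φ hφ => ?_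
    refine (hβ φ (uIcc_subset_Icc hs ht (uIoc_subset_uIcc hφ))).trans (le_abs_self M)
  exact intervalIntegral.integral_add_adjacent_intervals
    (hint _ ⟨hβa.le, hβc⟩ _ ⟨haθ.le, hc⟩)
    (hint _ ⟨haθ.le, hc⟩ _ ⟨haθ.le.trans hc, le_rfl⟩)

end ParametricIntegral

/-! ### The weight on the gap and the critical point. -/

/-- The weight `1 / √(1 - x ^ 2)` at the point `x = α - δ cos φ` of the gap. -/
noncomputable def gapWeight (δ α φ : ℝ) : ℝ := (√(1 - (α - δ * Real.cos φ) ^ 2))⁻¹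

/-- The derivative of `gapWeight` in `α`. -/
noncomputable def gapWeightDeriv (δ α φ : ℝ) : ℝ :=
  (α - δ * Real.cos φ) * gapWeight δ α φ ^ 3

/-- The distance from the centre `α` of the gap to the critical point of the Green function. -/
noncomputable def critOffset (δ α : ℝ) : ℝ :=
  -δ * (∫ φ in 0..Real.pi, Real.cos φ * gapWeight δ α φ) / ∫ φ in 0..Real.pi, gapWeight δ α φ

/-- The derivative of `critOffset` in `α`. -/
noncomputable def critOffsetDeriv (δ α : ℝ) : ℝ :=
  -δ * ((∫ φ in 0..Real.pi, Real.cos φ * gapWeightDeriv δ α φ) *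
      (∫ φ in 0..Real.pi, gapWeight δ α φ) -
    (∫ φ in 0..Real.pi, Real.cos φ * gapWeight δ α φ) *
      (∫ φ in 0..Real.pi, gapWeightDeriv δ α φ)) / (∫ φ in 0..Real.pi, gapWeight δ α φ) ^ 2

section Weight

variable {δ α : ℝ}

theorem gapPoint_mem (hδ : 0 < δ) (hα : α ∈ Ioo (δ - 1) (1 - δ)) (φ : ℝ) :
    α - δ * Real.cos φ ∈ Ioo (-1 : ℝ) 1 := by
  have h1 := Real.neg_one_le_cos φ
  have h2 := Real.cos_le_one φ
  constructor <;> nlinarith [hα.1, hα.2]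

theorem radicand_pos {x : ℝ} (hx : x ∈ Ioo (-1 : ℝ) 1) : 0 < 1 - x ^ 2 := by
  nlinarith [hx.1, hx.2]

theorem gapWeight_pos (hδ : 0 < δ) (hα : α ∈ Ioo (δ - 1) (1 - δ)) (φ : ℝ) :
    0 < gapWeight δ α φ :=
  inv_pos.2 (Real.sqrt_pos.2 (radicand_pos (gapPoint_mem hδ hα φ)))

theorem gapWeight_nonneg (δ α φ : ℝ) : 0 ≤ gapWeight δ α φ :=
  inv_nonneg.2 (Real.sqrt_nonneg _)

theorem continuousOn_gapWeight (hδ : 0 < δ) :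
    ContinuousOn (Function.uncurry (gapWeight δ)) (Ioo (δ - 1) (1 - δ) ×ˢ univ) := by
  unfold Function.uncurry gapWeight
  refine ContinuousOn.inv₀ (by fun_prop) fun p hp => ?_
  exact (Real.sqrt_pos.2 (radicand_pos (gapPoint_mem hδ hp.1 p.2))).ne'

theorem continuousOn_gapWeightDeriv (hδ : 0 < δ) :
    ContinuousOn (Function.uncurry (gapWeightDeriv δ)) (Ioo (δ - 1) (1 - δ) ×ˢ univ) := by
  have h1 : ContinuousOn (fun p : ℝ × ℝ => p.1 - δ * Real.cos p.2)
      (Ioo (δ - 1) (1 - δ) ×ˢ univ) := by fun_prop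
  exact h1.mul ((continuousOn_gapWeight hδ).pow 3)

theorem continuousOn_cos_mul {k : ℝ → ℝ → ℝ} {J : Set ℝ}
    (hk : ContinuousOn (Function.uncurry k) (J ×ˢ univ)) :
    ContinuousOn (Function.uncurry fun α φ => Real.cos φ * k α φ) (J ×ˢ univ) := by
  have h1 : ContinuousOn (fun p : ℝ × ℝ => Real.cos p.2) (J ×ˢ univ) := by fun_prop
  exact h1.mul hk

theorem continuous_gapWeight (hδ : 0 < δ) (hα : α ∈ Ioo (δ - 1) (1 - δ)) :
    Continuous (gapWeight δ α) :=
  continuous_section (continuousOn_gapWeight hδ) hα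

theorem continuous_gapWeightDeriv (hδ : 0 < δ) (hα : α ∈ Ioo (δ - 1) (1 - δ)) :
    Continuous (gapWeightDeriv δ α) :=
  continuous_section (continuousOn_gapWeightDeriv hδ) hα

theorem measurable_gapWeight (δ α : ℝ) : Measurable (gapWeight δ α) := by
  unfold gapWeight
  fun_prop

theorem hasDerivAt_inv_sqrt {x : ℝ} (hx : x ∈ Ioo (-1 : ℝ) 1) :
    HasDerivAt (fun y : ℝ => (√(1 - y ^ 2))⁻¹) (x * (√(1 - x ^ 2))⁻¹ ^ 3) x := by
  have hpos := radicand_pos hx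
  have h1 : HasDerivAt (fun y : ℝ => 1 - y ^ 2) (-(2 * x)) x := by
    simpa using ((hasDerivAt_id x).pow 2).const_sub 1
  have h2 := (h1.sqrt hpos.ne').inv (Real.sqrt_pos.2 hpos).ne'
  convert! h2 using 1
  have h3 := (Real.sqrt_pos.2 hpos).ne'
  field_simp

theorem hasDerivAt_gapWeight (hδ : 0 < δ) (hα : α ∈ Ioo (δ - 1) (1 - δ)) (φ : ℝ) :
    HasDerivAt (fun β => gapWeight δ β φ) (gapWeightDeriv δ α φ) α := by
  have h := (hasDerivAt_inv_sqrt (gapPoint_mem hδ hα φ)).comp_sub_const α (δ * Real.cos φ)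
  exact h

theorem hasDerivAt_gapWeight_angle (hδ : 0 < δ) (hα : α ∈ Ioo (δ - 1) (1 - δ)) (φ : ℝ) :
    HasDerivAt (gapWeight δ α) (gapWeightDeriv δ α φ * (δ * Real.sin φ)) φ := by
  have h1 : HasDerivAt (fun ψ => α - δ * Real.cos ψ) (δ * Real.sin φ) φ := by
    simpa using ((Real.hasDerivAt_cos φ).const_mul δ).const_sub α
  exact HasDerivAt.comp (h₂ := fun y : ℝ => (√(1 - y ^ 2))⁻¹) φ
    (hasDerivAt_inv_sqrt (gapPoint_mem hδ hα φ)) h1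

theorem integral_gapWeight_pos (hδ : 0 < δ) (hα : α ∈ Ioo (δ - 1) (1 - δ)) :
    0 < ∫ φ in 0..Real.pi, gapWeight δ α φ :=
  intervalIntegral.intervalIntegral_pos_of_pos
    ((continuous_gapWeight hδ hα).intervalIntegrable _ _) (gapWeight_pos hδ hα) Real.pi_pos

theorem critOffset_mul (hδ : 0 < δ) (hα : α ∈ Ioo (δ - 1) (1 - δ)) :
    critOffset δ α * (∫ φ in 0..Real.pi, gapWeight δ α φ) =
      -δ * ∫ φ in 0..Real.pi, Real.cos φ * gapWeight δ α φ :=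
  div_mul_cancel₀ _ (integral_gapWeight_pos hδ hα).ne'

/-- The offset is the $w$-weighted mean of $-\delta\cos\varphi$, whose values lie strictly between
$-\delta$ and $\delta$ on the open interval. -/
theorem abs_critOffset_lt (hδ : 0 < δ) (hα : α ∈ Ioo (δ - 1) (1 - δ)) :
    -δ < critOffset δ α ∧ critOffset δ α < δ := by
  have hK := continuous_gapWeight hδ hα
  have hI := integral_gapWeight_pos hδ hα
  have hcK : Continuous fun φ => Real.cos φ * gapWeight δ α φ := Real.continuous_cos.mul hK
  have hcos : ∀ φ ∈ Ioo 0 Real.pi, -1 < Real.cos φ ∧ Real.cos φ < 1 := by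
    intro φ hφ
    have h := Real.sin_pos_of_mem_Ioo hφ
    have h2 := Real.sin_sq_add_cos_sq φ
    constructor <;> nlinarith
  have h1 : 0 < ∫ φ in 0..Real.pi, (gapWeight δ α φ - Real.cos φ * gapWeight δ α φ) := by
    refine intervalIntegral.intervalIntegral_pos_of_pos_on
      ((hK.sub hcK).intervalIntegrable _ _) (fun φ hφ => ?_) Real.pi_pos
    nlinarith [gapWeight_pos hδ hα φ, hcos φ hφ]
  have h2 : 0 < ∫ φ in 0..Real.pi, (gapWeight δ α φ + Real.cos φ * gapWeight δ α φ) := by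
    refine intervalIntegral.intervalIntegral_pos_of_pos_on
      ((hK.add hcK).intervalIntegrable _ _) (fun φ hφ => ?_) Real.pi_pos
    nlinarith [gapWeight_pos hδ hα φ, hcos φ hφ]
  rw [intervalIntegral.integral_sub (hK.intervalIntegrable _ _) (hcK.intervalIntegrable _ _)] at h1
  rw [intervalIntegral.integral_add (hK.intervalIntegrable _ _) (hcK.intervalIntegrable _ _)] at h2
  rw [critOffset]
  constructor
  · rw [lt_div_iff₀ hI]
    nlinarith
  · rw [div_lt_iff₀ hI]
    nlinarith

theorem hasDerivAt_critOffset (hδ : 0 < δ) (hα : α ∈ Ioo (δ - 1) (1 - δ)) :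
    HasDerivAt (critOffset δ) (critOffsetDeriv δ α) α := by
  have h0 := hasDerivAt_parametric_intervalIntegral isOpen_Ioo (continuousOn_gapWeight hδ)
    (continuousOn_gapWeightDeriv hδ) (fun β hβ φ => hasDerivAt_gapWeight hδ hβ φ) hα 0 Real.pi
  have h1 := hasDerivAt_parametric_intervalIntegral isOpen_Ioo
    (continuousOn_cos_mul (continuousOn_gapWeight hδ))
    (continuousOn_cos_mul (continuousOn_gapWeightDeriv hδ))
    (fun β hβ φ => (hasDerivAt_gapWeight hδ hβ φ).const_mul (Real.cos φ)) hα 0 Real.pi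
  convert! (h1.const_mul (-δ)).div h0 (integral_gapWeight_pos hδ hα).ne' using 1
  rw [critOffsetDeriv]
  ring

/-- This is the logarithmic derivative of $(1-x^2)^{-1/2}$; its monotonicity drives
`critOffsetDeriv_nonneg`. -/
theorem monotoneOn_div_one_sub_sq :
    MonotoneOn (fun x : ℝ => x / (1 - x ^ 2)) (Ioo (-1) 1) := by
  intro x hx y hy hxy
  change x / (1 - x ^ 2) ≤ y / (1 - y ^ 2)
  rw [div_le_div_iff₀ (radicand_pos hx) (radicand_pos hy)]
  have : 0 < 1 + x * y := by nlinarith [hx.1, hx.2, hy.1, hy.2]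
  nlinarith [mul_nonneg (sub_nonneg.2 hxy) this.le]

/-- A Chebyshev-type argument. With $s=-\delta\cos\varphi$ and $\ell(x)=x/(1-x^2)$, one has
$\gamma'\int w=\int(s-\gamma)\,\partial_\alpha w$ and $\partial_\alpha w=\ell(\alpha+s)\,w$. Because
$\int(s-\gamma)w=0$, the constant $L=\ell(\alpha+\gamma)$ may be subtracted from $\ell$; then
$(s-\gamma)(\ell(\alpha+s)-L)\ge0$ pointwise. -/
theorem critOffsetDeriv_nonneg (hδ : 0 < δ) (hα : α ∈ Ioo (δ - 1) (1 - δ)) :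
    0 ≤ critOffsetDeriv δ α := by
  have hK := continuous_gapWeight hδ hα
  have hK' := continuous_gapWeightDeriv hδ hα
  have hI := integral_gapWeight_pos hδ hα
  have hγ := critOffset_mul hδ hα
  have hγlt := abs_critOffset_lt hδ hα
  set γ := critOffset δ α
  set I₀ := ∫ φ in 0..Real.pi, gapWeight δ α φ
  set I₁ := ∫ φ in 0..Real.pi, Real.cos φ * gapWeight δ α φ
  set L := (α + γ) / (1 - (α + γ) ^ 2)
  have hmem : α + γ ∈ Ioo (-1 : ℝ) 1 := ⟨by linarith [hα.1], by linarith [hα.2]⟩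
  have hpt : ∀ φ, 0 ≤ (-(δ * Real.cos φ) - γ) *
      (gapWeightDeriv δ α φ - L * gapWeight δ α φ) := by
    intro φ
    have hx := gapPoint_mem hδ hα φ
    have hrad := radicand_pos hx
    have hKpos := gapWeight_pos hδ hα φ
    have hfac : gapWeightDeriv δ α φ - L * gapWeight δ α φ =
        gapWeight δ α φ * ((α - δ * Real.cos φ) / (1 - (α - δ * Real.cos φ) ^ 2) - L) := by
      have hsq : gapWeight δ α φ ^ 2 = (1 - (α - δ * Real.cos φ) ^ 2)⁻¹ := by
        rw [gapWeight, inv_pow, Real.sq_sqrt hrad.le]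
      rw [gapWeightDeriv, pow_succ, hsq]
      ring
    rw [hfac]
    rcases le_total (α + γ) (α - δ * Real.cos φ) with h | h
    · have := monotoneOn_div_one_sub_sq hmem hx h
      exact mul_nonneg (by linarith) (mul_nonneg hKpos.le (sub_nonneg.2 this))
    · have := monotoneOn_div_one_sub_sq hx hmem h
      exact mul_nonneg_of_nonpos_of_nonpos (by linarith)
        (mul_nonpos_of_nonneg_of_nonpos hKpos.le (sub_nonpos.2 this))
  have hint : 0 ≤ ∫ φ in 0..Real.pi, (-(δ * Real.cos φ) - γ) *
      (gapWeightDeriv δ α φ - L * gapWeight δ α φ) :=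
    intervalIntegral.integral_nonneg Real.pi_pos.le fun φ _ => hpt φ
  set J₀ := ∫ φ in 0..Real.pi, gapWeightDeriv δ α φ
  set J₁ := ∫ φ in 0..Real.pi, Real.cos φ * gapWeightDeriv δ α φ
  have hexp : (∫ φ in 0..Real.pi, (-(δ * Real.cos φ) - γ) *
      (gapWeightDeriv δ α φ - L * gapWeight δ α φ)) =
      -δ * J₁ - γ * J₀ + L * δ * I₁ + L * γ * I₀ := by
    have hi : ∀ f : ℝ → ℝ, Continuous f → IntervalIntegrable f MeasureTheory.volume 0 Real.pi :=
      fun f hf => hf.intervalIntegrable _ _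
    have hcK : Continuous fun φ => Real.cos φ * gapWeight δ α φ := Real.continuous_cos.mul hK
    have hcK' : Continuous fun φ => Real.cos φ * gapWeightDeriv δ α φ :=
      Real.continuous_cos.mul hK'
    have : ∀ φ, (-(δ * Real.cos φ) - γ) * (gapWeightDeriv δ α φ - L * gapWeight δ α φ) =
        -δ * (Real.cos φ * gapWeightDeriv δ α φ) - γ * gapWeightDeriv δ α φ +
          L * δ * (Real.cos φ * gapWeight δ α φ) + L * γ * gapWeight δ α φ := fun φ => by ring
    simp only [this]
    rw [intervalIntegral.integral_add (hi _ (by fun_prop)) (hi _ (by fun_prop)),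
      intervalIntegral.integral_add (hi _ (by fun_prop)) (hi _ (by fun_prop)),
      intervalIntegral.integral_sub (hi _ (by fun_prop)) (hi _ (by fun_prop))]
    simp only [intervalIntegral.integral_const_mul]
    rfl
  rw [hexp] at hint
  have hval : critOffsetDeriv δ α = (-δ * J₁ - γ * J₀) / I₀ := by
    change -δ * (J₁ * I₀ - I₁ * J₀) / I₀ ^ 2 = _
    rw [div_eq_div_iff (pow_ne_zero 2 hI.ne') hI.ne']
    linear_combination (J₀ * I₀) * hγ
  rw [hval]
  refine div_nonneg ?_ hI.le
  have hzero : L * δ * I₁ + L * γ * I₀ = 0 := by linear_combination L * hγ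
  linarith

end Weight

/-! ### The integral formula in the gap. -/

/-- The integral representing the Green function at a point `x` of the gap `(α - δ, α + δ)`, when
the critical point of the Green function is `α + γ`. -/
noncomputable def gapGreen (δ α γ x : ℝ) : ℝ :=
  ∫ φ in Real.arccos ((α - x) / δ)..Real.pi, -(γ + δ * Real.cos φ) * gapWeight δ α φ

section ArccosIntegral

variable {f : ℝ → ℝ} {δ α x : ℝ}

theorem continuous_integral_arccos (hf : Continuous f) (δ α : ℝ) :
    Continuous fun x : ℝ => ∫ φ in Real.arccos ((α - x) / δ)..Real.pi, f φ := by
  have h1 : Continuous fun t : ℝ => ∫ φ in t..Real.pi, f φ := by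
    have h2 : Continuous fun t : ℝ => ∫ φ in Real.pi..t, f φ :=
      intervalIntegral.continuous_primitive (fun a b => hf.intervalIntegrable a b) _
    refine h2.neg.congr fun t => ?_
    exact (intervalIntegral.integral_symm _ _).symm
  exact h1.comp (by fun_prop)

theorem div_mem_Ioo_of_mem_gap (hδ : 0 < δ) (hx : x ∈ Ioo (α - δ) (α + δ)) :
    (α - x) / δ ∈ Ioo (-1 : ℝ) 1 := by
  constructor
  · rw [lt_div_iff₀ hδ]
    linarith [hx.2]
  · rw [div_lt_iff₀ hδ]
    linarith [hx.1]

theorem mul_sqrt_one_sub_div_sq (hδ : 0 < δ) (hx : x ∈ Ioo (α - δ) (α + δ)) :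
    δ * √(1 - ((α - x) / δ) ^ 2) = √(x - (α - δ)) * √(α + δ - x) := by
  rw [← Real.sqrt_mul (by linarith [hx.1])]
  nth_rewrite 1 [← Real.sqrt_sq hδ.le]
  rw [← Real.sqrt_mul (by positivity)]
  congr 1
  field_simp
  ring

theorem hasDerivAt_integral_arccos (hδ : 0 < δ) (hf : Continuous f)
    (hx : x ∈ Ioo (α - δ) (α + δ)) :
    HasDerivAt (fun y : ℝ => ∫ φ in Real.arccos ((α - y) / δ)..Real.pi, f φ)
      (-f (Real.arccos ((α - x) / δ)) / (√(x - (α - δ)) * √(α + δ - x))) x := by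
  have hy := div_mem_Ioo_of_mem_gap hδ hx
  have h1 : HasDerivAt (fun y : ℝ => (α - y) / δ) (-1 / δ) x :=
    ((hasDerivAt_id x).const_sub α).div_const δ
  have h2 := HasDerivAt.comp (h₂ := Real.arccos) x (Real.hasDerivAt_arccos hy.1.ne' hy.2.ne) h1
  have h3 : HasDerivAt (fun t : ℝ => ∫ φ in t..Real.pi, f φ)
      (-f (Real.arccos ((α - x) / δ))) (Real.arccos ((α - x) / δ)) :=
    intervalIntegral.integral_hasDerivAt_left (hf.intervalIntegrable _ _)
      (hf.stronglyMeasurableAtFilter _ _) hf.continuousAt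
  have h4 := HasDerivAt.comp (h₂ := fun t : ℝ => ∫ φ in t..Real.pi, f φ) x h3 h2
  convert! h4 using 1
  rw [← mul_sqrt_one_sub_div_sq hδ hx]
  have hs : 0 < √(1 - ((α - x) / δ) ^ 2) := Real.sqrt_pos.2 (radicand_pos hy)
  field_simp

/-- `Real.arccos` is constant beyond $[-1,1]$, so the formula for the gap makes sense on both bands
as well, without a case split. -/
theorem integral_arccos_of_le (hδ : 0 < δ) (hx : x ≤ α - δ) :
    ∫ φ in Real.arccos ((α - x) / δ)..Real.pi, f φ = ∫ φ in 0..Real.pi, f φ := by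
  rw [Real.arccos_eq_zero.2]
  rw [le_div_iff₀ hδ]
  linarith

theorem integral_arccos_of_ge (hδ : 0 < δ) (hx : α + δ ≤ x) :
    ∫ φ in Real.arccos ((α - x) / δ)..Real.pi, f φ = 0 := by
  rw [Real.arccos_eq_pi.2, intervalIntegral.integral_same]
  rw [div_le_iff₀ hδ]
  linarith

end ArccosIntegral

section GapGreen

variable {δ α γ x : ℝ}

theorem gapGreen_of_ge (hδ : 0 < δ) (hx : α + δ ≤ x) : gapGreen δ α γ x = 0 :=
  integral_arccos_of_ge hδ hx

theorem continuous_gapGreen_integrand (hδ : 0 < δ) (hα : α ∈ Ioo (δ - 1) (1 - δ)) (γ : ℝ) :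
    Continuous fun φ => -(γ + δ * Real.cos φ) * gapWeight δ α φ := by
  have := continuous_gapWeight hδ hα
  fun_prop

theorem integral_gapGreen_integrand (hδ : 0 < δ) (hα : α ∈ Ioo (δ - 1) (1 - δ)) :
    ∫ φ in 0..Real.pi, -(critOffset δ α + δ * Real.cos φ) * gapWeight δ α φ = 0 := by
  have hK := continuous_gapWeight hδ hα
  have h := critOffset_mul hδ hα
  have : ∀ φ, -(critOffset δ α + δ * Real.cos φ) * gapWeight δ α φ =
      -critOffset δ α * gapWeight δ α φ - δ * (Real.cos φ * gapWeight δ α φ) := fun φ => by ring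
  simp only [this]
  rw [intervalIntegral.integral_sub, intervalIntegral.integral_const_mul,
    intervalIntegral.integral_const_mul]
  · linarith
  · exact Continuous.intervalIntegrable (by fun_prop) _ _
  · exact Continuous.intervalIntegrable (by fun_prop) _ _

theorem gapGreen_of_le (hδ : 0 < δ) (hα : α ∈ Ioo (δ - 1) (1 - δ)) (hx : x ≤ α - δ) :
    gapGreen δ α (critOffset δ α) x = 0 :=
  (integral_arccos_of_le hδ hx).trans (integral_gapGreen_integrand hδ hα)

/-- Only continuity of the integrand is assumed, so that the degenerate case $\alpha=\delta-1$,
$\gamma=-\delta$ is covered too. -/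
theorem hasDerivAt_gapGreen (hδ : 0 < δ)
    (hf : Continuous fun φ => -(γ + δ * Real.cos φ) * gapWeight δ α φ)
    (hx : x ∈ Ioo (α - δ) (α + δ)) (hx1 : x ∈ Ioo (-1 : ℝ) 1) :
    HasDerivAt (gapGreen δ α γ)
      ((α + γ - x) / (√(x + 1) * √(1 - x) * √(x - (α - δ)) * √(α + δ - x))) x := by
  have hy := div_mem_Ioo_of_mem_gap hδ hx
  convert! hasDerivAt_integral_arccos hδ hf hx using 1
  have hcos : δ * Real.cos (Real.arccos ((α - x) / δ)) = α - x := by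
    rw [Real.cos_arccos hy.1.le hy.2.le]
    field_simp
  have hw : gapWeight δ α (Real.arccos ((α - x) / δ)) = (√(x + 1) * √(1 - x))⁻¹ := by
    rw [gapWeight, hcos, ← Real.sqrt_mul (by linarith [hx1.1])]
    congr 2
    ring
  have h1 : 0 < √(x + 1) := Real.sqrt_pos.2 (by linarith [hx1.1])
  have h2 : 0 < √(1 - x) := Real.sqrt_pos.2 (by linarith [hx1.2])
  have h3 : 0 < √(x - (α - δ)) := Real.sqrt_pos.2 (by linarith [hx.1])
  have h4 : 0 < √(α + δ - x) := Real.sqrt_pos.2 (by linarith [hx.2])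
  rw [hw, hcos]
  field_simp
  ring

end GapGreen

/-! ### Identification of both Green functions with the integral formula. -/

section Identification

variable {δ α x : ℝ}

theorem upperSqrt_sub_of_le {x e : ℝ} (h : e ≤ x) :
    upperSqrt ((x : ℂ) - e) = (√(x - e) : ℝ) := by
  rw [← Complex.ofReal_sub, upperSqrt_ofReal_of_nonneg (by linarith)]

theorem upperSqrt_sub_of_ge {x e : ℝ} (h : x ≤ e) :
    upperSqrt ((x : ℂ) - e) = Complex.I * (√(e - x) : ℝ) := by
  rw [← Complex.ofReal_sub, upperSqrt_ofReal_of_nonpos (by linarith), neg_sub]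

theorem branchQuot_four {n : ℂ → ℂ} {e₁ e₂ e₃ e₄ : ℝ} (h₁ : e₁ < e₂) (h₂ : e₂ < e₃) (h₃ : e₃ < e₄)
    (z : ℂ) : branchQuot n {e₁, e₂, e₃, e₄} z =
      n z / (upperSqrt (z - e₁) * upperSqrt (z - e₂) * upperSqrt (z - e₃) *
        upperSqrt (z - e₄)) := by
  rw [branchQuot, Finset.prod_insert, Finset.prod_insert, Finset.prod_pair h₃.ne, ← mul_assoc,
    ← mul_assoc]
  · simp [h₂.ne, (h₂.trans h₃).ne]
  · simp [h₁.ne, (h₁.trans h₂).ne, (h₁.trans (h₂.trans h₃)).ne]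

/-- Each branch point to the right of a real $x$ contributes a factor $i$ to the denominator. The
quotient is thus real in the gap and outside $[-1,1]$, where an even number lie to the right, and
imaginary on the two bands, where the real part of the primitive is constant. The choice of
`critOffset` makes the two constants equal. -/
theorem exists_isGreenAtInfty_twoIntervals (hδ : 0 < δ) (hα : α ∈ Ioo (δ - 1) (1 - δ)) :
    ∃ g : ℂ → ℝ, IsGreenAtInfty (twoIntervals α δ) g ∧
      ∀ x ∈ Icc (-1 : ℝ) 1, g x = gapGreen δ α (critOffset δ α) x := by
  have ha : -1 < α - δ := by linarith [hα.1]
  have hab : α - δ < α + δ := by linarith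
  have hb : α + δ < 1 := by linarith [hα.2]
  set c : ℝ := α + critOffset δ α with hc
  set n : ℂ → ℂ := fun z => z - c with hn
  have hnd : Differentiable ℂ n := differentiable_id.sub_const _
  have hquot := branchQuot_four (n := n) ha hab hb
  have hcard : ({-1, α - δ, α + δ, 1} : Finset ℝ).card = 2 * 2 := by
    rw [Finset.card_insert_of_notMem, Finset.card_insert_of_notMem, Finset.card_pair hb.ne]
    · simp [hab.ne, (hab.trans hb).ne]
    · simp [ha.ne, (ha.trans hab).ne, (ha.trans (hab.trans hb)).ne]
  obtain ⟨C, R, hR, hasymp⟩ := exists_norm_branchQuot_sub_inv_le (n := n) hcard (by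
    refine (Asymptotics.isBigO_const_mul_self (-(c : ℂ)) (fun z : ℂ => z⁻¹) upperInfty).congr'
      ?_ EventuallyEq.rfl
    filter_upwards [eventually_upperInfty_ne_zero] with z hz
    simp only [hn]
    field_simp
    ring)
  have hcont := continuous_gapGreen_integrand hδ hα (critOffset δ α)
  refine exists_isGreenAtInfty hnd (isClosed_Icc.sdiff isOpen_Ioo)
    ⟨1, by simp; intro; linarith⟩ ?_ (p := -1) (q := 1) sdiff_subset ?_
    (continuous_integral_arccos hcont δ α).continuousOn ?_ ?_ hR hasymp
  · intro e he
    simp only [Finset.mem_insert, Finset.mem_singleton] at he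
    simp only [Set.mem_sdiff, mem_Icc, mem_Ioo, not_and, not_lt]
    rcases he with rfl | rfl | rfl | rfl
    · exact ⟨⟨le_rfl, by norm_num⟩, fun h => by linarith⟩
    · exact ⟨⟨ha.le, by linarith⟩, fun h => by linarith⟩
    · exact ⟨⟨by linarith, hb.le⟩, fun _ => le_rfl⟩
    · exact ⟨⟨by norm_num, le_rfl⟩, fun _ => hb.le⟩
  · intro x hx
    have hI4 : ∀ p q r s : ℂ, Complex.I * p * (Complex.I * q) * (Complex.I * r) *
        (Complex.I * s) = p * q * r * s := fun p q r s => by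
      linear_combination (p * q * r * s) * Complex.I_pow_four
    have hI2 : ∀ p q r s : ℂ, p * q * (Complex.I * r) * (Complex.I * s) = -(p * q * r * s) :=
      fun p q r s => by linear_combination (p * q * r * s) * Complex.I_sq
    rw [hquot]
    simp only [hn]
    rcases lt_or_ge x (-1) with h1 | h1
    · rw [upperSqrt_sub_of_ge (by linarith), upperSqrt_sub_of_ge (by linarith),
        upperSqrt_sub_of_ge (by linarith), upperSqrt_sub_of_ge (by linarith), hI4]
      norm_cast
    rcases lt_or_ge 1 x with h2 | h2
    · rw [upperSqrt_sub_of_le (by linarith), upperSqrt_sub_of_le (by linarith),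
        upperSqrt_sub_of_le (by linarith), upperSqrt_sub_of_le (by linarith)]
      norm_cast
    · have h3 : x ∈ Ioo (α - δ) (α + δ) := by
        by_contra h
        exact hx ⟨⟨h1, h2⟩, h⟩
      rw [upperSqrt_sub_of_le (by linarith), upperSqrt_sub_of_le (by linarith [h3.1]),
        upperSqrt_sub_of_ge (by linarith [h3.2]), upperSqrt_sub_of_ge (by linarith), hI2]
      norm_cast
  · intro x hx hxS
    simp only [Finset.mem_insert, Finset.mem_singleton, not_or] at hxS
    rw [hquot]
    simp only [hn]
    rcases lt_or_gt_of_ne hxS.2.1 with h1 | h1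
    · have hzero : HasDerivAt (gapGreen δ α (critOffset δ α)) 0 x := by
        refine (hasDerivAt_const x (0 : ℝ)).congr_of_eventuallyEq ?_
        filter_upwards [Iio_mem_nhds h1] with y hy
        exact gapGreen_of_le hδ hα hy.le
      convert! hzero using 1
      rw [upperSqrt_sub_of_le (by linarith [hx.1]), upperSqrt_sub_of_ge (by linarith),
        upperSqrt_sub_of_ge (by linarith), upperSqrt_sub_of_ge (by linarith [hx.2])]
      have hI3 : ∀ p q r s : ℂ, p * (Complex.I * q) * (Complex.I * r) *
          (Complex.I * s) = -(Complex.I * (p * q * r * s)) := fun p q r s => by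
        linear_combination (p * q * r * s * Complex.I) * Complex.I_sq
      rw [hI3, div_neg, Complex.neg_re, neg_eq_zero, ← Complex.ofReal_sub, ← Complex.ofReal_mul,
        ← Complex.ofReal_mul, ← Complex.ofReal_mul, Complex.div_re]
      simp
    rcases lt_or_gt_of_ne hxS.2.2.1 with h2 | h2
    · convert! hasDerivAt_gapGreen hδ hcont ⟨h1, h2⟩ hx using 1
      rw [upperSqrt_sub_of_le (by linarith [hx.1]), upperSqrt_sub_of_le (by linarith),
        upperSqrt_sub_of_ge (by linarith), upperSqrt_sub_of_ge (by linarith [hx.2])]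
      have hI2 : ∀ p q r s : ℂ, p * q * (Complex.I * r) * (Complex.I * s) = -(p * s * q * r) :=
        fun p q r s => by linear_combination (p * q * r * s) * Complex.I_sq
      rw [hI2, div_neg, ← neg_div, neg_sub, sub_neg_eq_add]
      norm_cast
    · have hzero : HasDerivAt (gapGreen δ α (critOffset δ α)) 0 x := by
        refine (hasDerivAt_const x (0 : ℝ)).congr_of_eventuallyEq ?_
        filter_upwards [Ioi_mem_nhds h2] with y hy
        exact gapGreen_of_ge hδ hy.le
      convert! hzero using 1
      rw [upperSqrt_sub_of_le (by linarith [hx.1]), upperSqrt_sub_of_le (by linarith),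
        upperSqrt_sub_of_le (by linarith), upperSqrt_sub_of_ge (by linarith [hx.2]),
        mul_left_comm, ← Complex.ofReal_sub, ← Complex.ofReal_mul,
        ← Complex.ofReal_mul, ← Complex.ofReal_mul, Complex.div_re]
      simp
  · intro x hx
    by_cases h1 : x ≤ α - δ
    · exact gapGreen_of_le hδ hα h1
    · refine gapGreen_of_ge hδ ?_
      by_contra h2
      exact hx.2 ⟨not_le.1 h1, not_le.1 h2⟩

theorem greenTwo_eq_gapGreen (hδ : 0 < δ) (hα : α ∈ Ioo (δ - 1) (1 - δ))
    (hx : x ∈ Icc (-1 : ℝ) 1) : greenTwo α δ x = gapGreen δ α (critOffset δ α) x := by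
  obtain ⟨g, hg, hgx⟩ := exists_isGreenAtInfty_twoIntervals hδ hα
  have hne : (twoIntervals α δ).Nonempty :=
    ⟨_, 1, ⟨by norm_num, fun h => by linarith [h.2, hα.2]⟩, rfl⟩
  rw [greenTwo, hg.greenAtInfty_eq hne, hgx x hx]

/-- At $\alpha=\delta-1$ the weight blows up where $\cos\varphi=1$, but the numerator
$\delta(1-\cos\varphi)$ is the square of the vanishing factor of the denominator. At the singular
angles themselves both sides are $0$, the inverse of $0$ being $0$. -/
theorem continuous_gapGreen_integrand_left (hδ : 0 < δ) (hδ1 : δ < 1) :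
    Continuous fun φ => -(-δ + δ * Real.cos φ) * gapWeight δ (δ - 1) φ := by
  have heq : (fun φ => -(-δ + δ * Real.cos φ) * gapWeight δ (δ - 1) φ) =
      fun φ => √(δ * (1 - Real.cos φ)) / √(2 - δ + δ * Real.cos φ) := by
    funext φ
    have h1 : 0 ≤ δ * (1 - Real.cos φ) := mul_nonneg hδ.le (by linarith [Real.cos_le_one φ])
    have h2 : 1 - (δ - 1 - δ * Real.cos φ) ^ 2 =
        δ * (1 - Real.cos φ) * (2 - δ + δ * Real.cos φ) := by ring
    have h3 : -(-δ + δ * Real.cos φ) = √(δ * (1 - Real.cos φ)) * √(δ * (1 - Real.cos φ)) := by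
      rw [Real.mul_self_sqrt h1]; ring
    rw [gapWeight, h2, Real.sqrt_mul h1, h3]
    rcases (Real.sqrt_nonneg (δ * (1 - Real.cos φ))).eq_or_lt with h0 | hpos
    · simp [← h0]
    · rw [mul_inv, ← mul_assoc, mul_assoc (√(δ * (1 - Real.cos φ))), mul_inv_cancel₀ hpos.ne',
        mul_one, div_eq_mul_inv]
  rw [heq]
  refine Continuous.div (by fun_prop) (by fun_prop) fun φ => (Real.sqrt_pos.2 ?_).ne'
  nlinarith [Real.neg_one_le_cos φ]

theorem exists_isGreenAtInfty_oneInterval (hδ : 0 < δ) (hδ1 : δ < 1) :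
    ∃ g : ℂ → ℝ, IsGreenAtInfty (oneInterval δ) g ∧
      ∀ x ∈ Icc (-1 : ℝ) 1, g x = gapGreen δ (δ - 1) (-δ) x := by
  have hb : -1 + 2 * δ < 1 := by linarith
  have hquot : ∀ z : ℂ, branchQuot (fun _ => 1) {-1 + 2 * δ, 1} z =
      1 / (upperSqrt (z - (-1 + 2 * δ : ℝ)) * upperSqrt (z - (1 : ℝ))) := fun z => by
    rw [branchQuot, Finset.prod_pair hb.ne]
  have hcard : ({-1 + 2 * δ, 1} : Finset ℝ).card = 2 * 1 := Finset.card_pair hb.ne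
  obtain ⟨C, R, hR, hasymp⟩ := exists_norm_branchQuot_sub_inv_le (n := fun _ => 1) hcard (by
    refine (Asymptotics.isBigO_zero (fun z : ℂ => z⁻¹) upperInfty).congr' ?_ EventuallyEq.rfl
    filter_upwards [eventually_upperInfty_ne_zero] with z hz
    field_simp
    ring)
  have hcont := continuous_gapGreen_integrand_left hδ hδ1
  have hI2 : ∀ p q : ℂ, Complex.I * p * (Complex.I * q) = -(p * q) :=
    fun p q => by linear_combination (p * q) * Complex.I_sq
  refine exists_isGreenAtInfty (differentiable_const 1) isClosed_Icc
    ⟨1, hb.le, le_rfl⟩ ?_ (p := -1) (q := 1) (Icc_subset_Icc_left (by linarith)) ?_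
    (continuous_integral_arccos hcont δ (δ - 1)).continuousOn ?_ ?_ hR hasymp
  · intro e he
    simp only [Finset.mem_insert, Finset.mem_singleton] at he
    rcases he with rfl | rfl
    · exact ⟨le_rfl, hb.le⟩
    · exact ⟨hb.le, le_rfl⟩
  · intro x hx
    rw [hquot]
    rcases lt_or_ge x (-1 + 2 * δ) with h1 | h1
    · rw [upperSqrt_sub_of_ge h1.le, upperSqrt_sub_of_ge (by linarith), hI2]
      norm_cast
    · have h2 : 1 < x := by
        by_contra h
        exact hx ⟨h1, not_lt.1 h⟩
      rw [upperSqrt_sub_of_le h1, upperSqrt_sub_of_le h2.le]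
      norm_cast
  · intro x hx hxS
    simp only [Finset.mem_insert, Finset.mem_singleton, not_or] at hxS
    rw [hquot]
    rcases lt_or_gt_of_ne hxS.1 with h1 | h1
    · convert! hasDerivAt_gapGreen hδ hcont (x := x)
        ⟨by linarith [hx.1], by linarith⟩ hx using 1
      rw [upperSqrt_sub_of_ge h1.le, upperSqrt_sub_of_ge hx.2.le, hI2, div_neg]
      have e1 : x - (δ - 1 - δ) = x + 1 := by ring
      have e2 : δ - 1 + δ - x = -1 + 2 * δ - x := by ring
      -- The critical point has merged with the branch point $-1$: the numerator cancels
      -- $\sqrt{x+1}$ twice, leaving the derivative for a single interval.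
      have e3 : δ - 1 + -δ - x = -(√(x + 1) * √(x + 1)) := by
        rw [Real.mul_self_sqrt (by linarith [hx.1])]; ring
      have hp : 0 < √(x + 1) := Real.sqrt_pos.2 (by linarith [hx.1])
      have hq : 0 < √(1 - x) := Real.sqrt_pos.2 (by linarith [hx.2])
      have hr : 0 < √(-1 + 2 * δ - x) := Real.sqrt_pos.2 (by linarith)
      rw [e1, e2, e3]
      norm_cast
      field_simp
    · have hzero : HasDerivAt (gapGreen δ (δ - 1) (-δ)) 0 x := by
        refine (hasDerivAt_const x (0 : ℝ)).congr_of_eventuallyEq ?_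
        filter_upwards [Ioi_mem_nhds h1] with y hy
        exact gapGreen_of_ge hδ (by linarith [mem_Ioi.1 hy])
      convert! hzero using 1
      rw [upperSqrt_sub_of_le h1.le, upperSqrt_sub_of_ge hx.2.le,
        mul_left_comm, ← Complex.ofReal_mul, Complex.div_re]
      simp
  · intro x hx
    exact gapGreen_of_ge hδ (by linarith [hx.1])

theorem greenOne_eq_gapGreen (hδ : 0 < δ) (hδ1 : δ < 1) (hx : x ∈ Icc (-1 : ℝ) 1) :
    greenOne δ x = gapGreen δ (δ - 1) (-δ) x := by
  obtain ⟨g, hg, hgx⟩ := exists_isGreenAtInfty_oneInterval hδ hδ1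
  have hne : (oneInterval δ).Nonempty := ⟨_, 1, ⟨by linarith, le_rfl⟩, rfl⟩
  rw [greenOne, hg.greenAtInfty_eq hne, hgx x hx]

end Identification

/-! ### The derivative in the position of the gap. -/

/-- The derivative of `greenTwo α δ x` in `α`, at the point `x = α - δ cos θ` of the gap. -/
noncomputable def gapGreenDeriv (δ α θ : ℝ) : ℝ :=
  -critOffsetDeriv δ α * (∫ φ in θ..Real.pi, gapWeight δ α φ) -
    critOffset δ α * (∫ φ in θ..Real.pi, gapWeightDeriv δ α φ) -
    δ * (∫ φ in θ..Real.pi, Real.cos φ * gapWeightDeriv δ α φ) -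
    (critOffset δ α + δ * Real.cos θ) * gapWeight δ α θ / (δ * Real.sin θ)

section Derivative

variable {δ α x : ℝ}

theorem gapGreen_eq_sub (hδ : 0 < δ) (hα : α ∈ Ioo (δ - 1) (1 - δ)) (γ x : ℝ) :
    gapGreen δ α γ x =
      -γ * (∫ φ in Real.arccos ((α - x) / δ)..Real.pi, gapWeight δ α φ) -
      δ * ∫ φ in Real.arccos ((α - x) / δ)..Real.pi, Real.cos φ * gapWeight δ α φ := by
  have hK := continuous_gapWeight hδ hα
  have : ∀ φ, -(γ + δ * Real.cos φ) * gapWeight δ α φ =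
      -γ * gapWeight δ α φ - δ * (Real.cos φ * gapWeight δ α φ) := fun φ => by ring
  simp only [gapGreen, this]
  rw [intervalIntegral.integral_sub, intervalIntegral.integral_const_mul,
    intervalIntegral.integral_const_mul]
  · exact Continuous.intervalIntegrable (by fun_prop) _ _
  · exact Continuous.intervalIntegrable (by fun_prop) _ _

theorem gap_subset_Icc (hα : α ∈ Ioo (δ - 1) (1 - δ)) (hx : x ∈ Ioo (α - δ) (α + δ)) :
    x ∈ Icc (-1 : ℝ) 1 :=
  ⟨by linarith [hα.1, hx.1], by linarith [hα.2, hx.2]⟩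

theorem hasDerivAt_greenTwo (hδ : 0 < δ) (hα : α ∈ Ioo (δ - 1) (1 - δ))
    (hx : x ∈ Ioo (α - δ) (α + δ)) :
    HasDerivAt (fun β => greenTwo β δ x)
      (gapGreenDeriv δ α (Real.arccos ((α - x) / δ))) α := by
  have hy := div_mem_Ioo_of_mem_gap hδ hx
  have hθ : HasDerivAt (fun β : ℝ => Real.arccos ((β - x) / δ))
      (-(1 / √(1 - ((α - x) / δ) ^ 2)) * (1 / δ)) α :=
    HasDerivAt.comp (h₂ := Real.arccos) α (Real.hasDerivAt_arccos hy.1.ne' hy.2.ne)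
      (((hasDerivAt_id α).sub_const x).div_const δ)
  have h0 := hasDerivAt_intervalIntegral_moving isOpen_Ioo (continuousOn_gapWeight hδ)
    (continuousOn_gapWeightDeriv hδ) (fun β hβ φ => hasDerivAt_gapWeight hδ hβ φ) hα hθ Real.pi
  have h1 := hasDerivAt_intervalIntegral_moving isOpen_Ioo
    (continuousOn_cos_mul (continuousOn_gapWeight hδ))
    (continuousOn_cos_mul (continuousOn_gapWeightDeriv hδ))
    (fun β hβ φ => (hasDerivAt_gapWeight hδ hβ φ).const_mul (Real.cos φ)) hα hθ Real.pi
  have h := ((hasDerivAt_critOffset hδ hα).neg.mul h0).sub (h1.const_mul δ)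
  have h' : HasDerivAt (fun β => greenTwo β δ x) _ α := h.congr_of_eventuallyEq (by
    filter_upwards [isOpen_Ioo.mem_nhds hα] with β hβ
    rw [greenTwo_eq_gapGreen hδ hβ (gap_subset_Icc hα hx), gapGreen_eq_sub hδ hβ]
    rfl)
  convert! h' using 1
  have hs : 0 < √(1 - ((α - x) / δ) ^ 2) := Real.sqrt_pos.2 (radicand_pos hy)
  simp only [gapGreenDeriv, Real.sin_arccos, Pi.neg_apply]
  field_simp
  ring

/-- The terms containing $\partial_\alpha w$ cancel: those from the integrals against the one from
differentiating $w$ in the boundary term, since $\partial_\theta w=\delta\sin\theta\,\partial_\alpha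
w$. Only a multiple of $w$ remains. -/
theorem hasDerivAt_gapGreenDeriv (hδ : 0 < δ) (hα : α ∈ Ioo (δ - 1) (1 - δ)) {θ : ℝ}
    (hθ : θ ∈ Ioo 0 Real.pi) :
    HasDerivAt (gapGreenDeriv δ α) (gapWeight δ α θ * (critOffsetDeriv δ α +
      (δ + critOffset δ α * Real.cos θ) / (δ * Real.sin θ ^ 2))) θ := by
  have hK := continuous_gapWeight hδ hα
  have hK' := continuous_gapWeightDeriv hδ hα
  have hsin := Real.sin_pos_of_mem_Ioo hθ
  have hprim : ∀ f : ℝ → ℝ, Continuous f →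
      HasDerivAt (fun t : ℝ => ∫ φ in t..Real.pi, f φ) (-f θ) θ := fun f hf =>
    intervalIntegral.integral_hasDerivAt_left (hf.intervalIntegrable _ _)
      (hf.stronglyMeasurableAtFilter _ _) hf.continuousAt
  have h1 := (hprim _ hK).const_mul (-critOffsetDeriv δ α)
  have h2 := (hprim _ hK').const_mul (critOffset δ α)
  have h3 := (hprim (fun φ => Real.cos φ * gapWeightDeriv δ α φ)
    (Real.continuous_cos.mul hK')).const_mul δ
  have h4 := ((((Real.hasDerivAt_cos θ).const_mul δ).const_add (critOffset δ α)).mul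
    (hasDerivAt_gapWeight_angle hδ hα θ)).div ((Real.hasDerivAt_sin θ).const_mul δ)
    (mul_pos hδ hsin).ne'
  convert! ((h1.sub h2).sub h3).sub h4 using 1
  simp only [Pi.mul_apply]
  field_simp
  linear_combination -(gapWeight δ α θ * δ) * Real.sin_sq_add_cos_sq θ

theorem strictMonoOn_gapGreenDeriv (hδ : 0 < δ) (hα : α ∈ Ioo (δ - 1) (1 - δ)) :
    StrictMonoOn (gapGreenDeriv δ α) (Ioo 0 Real.pi) := by
  refine strictMonoOn_of_deriv_pos (convex_Ioo _ _)
    (fun θ hθ => (hasDerivAt_gapGreenDeriv hδ hα hθ).continuousAt.continuousWithinAt) ?_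
  intro θ hθ
  rw [interior_Ioo] at hθ
  rw [(hasDerivAt_gapGreenDeriv hδ hα hθ).deriv]
  have hsin := Real.sin_pos_of_mem_Ioo hθ
  have hγ := abs_critOffset_lt hδ hα
  have hnum : 0 < δ + critOffset δ α * Real.cos θ := by
    have h1 : |critOffset δ α * Real.cos θ| < δ := by
      rw [abs_mul]
      exact (mul_le_of_le_one_right (abs_nonneg _) (Real.abs_cos_le_one θ)).trans_lt (abs_lt.2 hγ)
    linarith [(abs_lt.1 h1).1]
  exact mul_pos (gapWeight_pos hδ hα θ)
    (add_pos_of_nonneg_of_pos (critOffsetDeriv_nonneg hδ hα) (by positivity))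

theorem exists_gapGreenDeriv_eq_zero (hδ : 0 < δ) (hα : α ∈ Ioo (δ - 1) (1 - δ)) :
    ∃ θ ∈ Ioo 0 Real.pi, gapGreenDeriv δ α θ = 0 := by
  have hK := continuous_gapWeight hδ hα
  have hK' := continuous_gapWeightDeriv hδ hα
  have hγ := abs_critOffset_lt hδ hα
  have hprim : ∀ f : ℝ → ℝ, Continuous f →
      Continuous (fun t : ℝ => ∫ φ in t..Real.pi, f φ) := fun f hf => by
    have h2 : Continuous fun t : ℝ => ∫ φ in Real.pi..t, f φ :=
      intervalIntegral.continuous_primitive (fun a b => hf.intervalIntegrable a b) _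
    refine h2.neg.congr fun t => ?_
    exact (intervalIntegral.integral_symm _ _).symm
  have c1 := hprim _ hK
  have c2 := hprim _ hK'
  have c3 := hprim (fun φ => Real.cos φ * gapWeightDeriv δ α φ) (Real.continuous_cos.mul hK')
  -- Multiplication by $\sin\theta$ removes the singularity of the boundary term. At the ends only
  -- that term survives, and $|\gamma|<\delta$ determines its sign.
  set m : ℝ → ℝ := fun θ => Real.sin θ *
    (-critOffsetDeriv δ α * (∫ φ in θ..Real.pi, gapWeight δ α φ) -
    critOffset δ α * (∫ φ in θ..Real.pi, gapWeightDeriv δ α φ) -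
    δ * (∫ φ in θ..Real.pi, Real.cos φ * gapWeightDeriv δ α φ)) -
    (critOffset δ α + δ * Real.cos θ) * gapWeight δ α θ / δ with hm
  have hmc : Continuous m := by fun_prop
  have h0 : m 0 < 0 := by
    have : m 0 = -((critOffset δ α + δ) * gapWeight δ α 0 / δ) := by simp [hm]
    rw [this, neg_lt_zero]
    exact div_pos (mul_pos (by linarith) (gapWeight_pos hδ hα 0)) hδ
  have hπ : 0 < m Real.pi := by
    have : m Real.pi = (δ - critOffset δ α) * gapWeight δ α Real.pi / δ := by
      simp [hm]; ring
    rw [this]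
    exact div_pos (mul_pos (by linarith) (gapWeight_pos hδ hα _)) hδ
  obtain ⟨θ, hθ, hmθ⟩ := intermediate_value_Ioo Real.pi_pos.le hmc.continuousOn
    (show (0 : ℝ) ∈ Ioo (m 0) (m Real.pi) from ⟨h0, hπ⟩)
  refine ⟨θ, hθ, ?_⟩
  have hsin := Real.sin_pos_of_mem_Ioo hθ
  have hrel : m θ = Real.sin θ * gapGreenDeriv δ α θ := by
    simp only [hm, gapGreenDeriv]
    field_simp
  rw [hrel] at hmθ
  exact (mul_eq_zero.1 hmθ).resolve_left hsin.ne'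

theorem arccos_mem_Ioo (hδ : 0 < δ) (hx : x ∈ Ioo (α - δ) (α + δ)) :
    Real.arccos ((α - x) / δ) ∈ Ioo 0 Real.pi := by
  have hy := div_mem_Ioo_of_mem_gap hδ hx
  refine ⟨Real.arccos_pos.2 hy.2, lt_of_le_of_ne (Real.arccos_le_pi _) fun h => ?_⟩
  exact absurd (Real.arccos_eq_pi.1 h) (not_le.2 hy.1)

/-- In the gap, the derivative of the Green function in `α` increases with `x`. -/
theorem strictMonoOn_deriv_greenTwo (hδ : 0 < δ) (hα : α ∈ Ioo (δ - 1) (1 - δ)) :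
    StrictMonoOn (fun x => deriv (fun β => greenTwo β δ x) α) (Ioo (α - δ) (α + δ)) := by
  intro x hx y hy hxy
  simp only [(hasDerivAt_greenTwo hδ hα hx).deriv, (hasDerivAt_greenTwo hδ hα hy).deriv]
  refine strictMonoOn_gapGreenDeriv hδ hα (arccos_mem_Ioo hδ hx) (arccos_mem_Ioo hδ hy) ?_
  have h1 := div_mem_Ioo_of_mem_gap hδ hx
  have h2 := div_mem_Ioo_of_mem_gap hδ hy
  refine Real.strictAntiOn_arccos ⟨h2.1.le, h2.2.le⟩ ⟨h1.1.le, h1.2.le⟩ ?_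
  exact div_lt_div_of_pos_right (by linarith) hδ

theorem exists_deriv_greenTwo_eq_zero (hδ : 0 < δ) (hα : α ∈ Ioo (δ - 1) (1 - δ)) :
    ∃ x ∈ Ioo (α - δ) (α + δ), deriv (fun β => greenTwo β δ x) α = 0 := by
  obtain ⟨θ, hθ, h0⟩ := exists_gapGreenDeriv_eq_zero hδ hα
  have hsin := Real.sin_pos_of_mem_Ioo hθ
  have hsq := Real.sin_sq_add_cos_sq θ
  have hx : α - δ * Real.cos θ ∈ Ioo (α - δ) (α + δ) := by
    have h1 : Real.cos θ < 1 := by nlinarith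
    have h2 : -1 < Real.cos θ := by nlinarith
    constructor <;> nlinarith
  refine ⟨_, hx, ?_⟩
  rw [(hasDerivAt_greenTwo hδ hα hx).deriv]
  have : (α - (α - δ * Real.cos θ)) / δ = Real.cos θ := by
    field_simp
    ring
  rw [this, Real.arccos_cos hθ.1.le hθ.2.le, h0]

end Derivative

/-! ### Symmetry under reflection of the gap. -/

section Symmetry

variable {δ α : ℝ}

theorem gapWeight_neg_pi_sub (δ α φ : ℝ) : gapWeight δ (-α) (Real.pi - φ) = gapWeight δ α φ := by
  rw [gapWeight, gapWeight, Real.cos_pi_sub]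
  congr 3
  ring

theorem integral_comp_pi_sub (f : ℝ → ℝ) :
    ∫ φ in 0..Real.pi, f φ = ∫ φ in 0..Real.pi, f (Real.pi - φ) := by
  rw [intervalIntegral.integral_comp_sub_left f Real.pi]
  simp

theorem critOffset_neg (δ α : ℝ) : critOffset δ (-α) = -critOffset δ α := by
  unfold critOffset
  rw [integral_comp_pi_sub (gapWeight δ (-α)),
    integral_comp_pi_sub fun φ => Real.cos φ * gapWeight δ (-α) φ]
  simp only [gapWeight_neg_pi_sub, Real.cos_pi_sub, neg_mul, intervalIntegral.integral_neg]
  ring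

/-- The change $\varphi\mapsto\pi-\varphi$ turns the integral over $[\pi-\theta,\pi]$ into minus the
original integrand over $[0,\theta]$, which equals the integral over $[\theta,\pi]$ because the
total is zero. -/
theorem gapGreen_neg_zero (hδ : 0 < δ) (hα : α ∈ Ioo (δ - 1) (1 - δ)) :
    gapGreen δ (-α) (critOffset δ (-α)) 0 = gapGreen δ α (critOffset δ α) 0 := by
  have hc := continuous_gapGreen_integrand hδ hα (critOffset δ α)
  have harc : Real.arccos ((-α - 0) / δ) = Real.pi - Real.arccos ((α - 0) / δ) := by
    rw [← Real.arccos_neg]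
    congr 1
    ring
  rw [gapGreen, gapGreen, harc, critOffset_neg]
  set θ := Real.arccos ((α - 0) / δ)
  have h1 := intervalIntegral.integral_comp_sub_left
    (fun φ => -(-critOffset δ α + δ * Real.cos φ) * gapWeight δ (-α) φ) (a := 0) (b := θ) Real.pi
  rw [sub_zero] at h1
  rw [← h1]
  have h2 : ∀ φ, -(-critOffset δ α + δ * Real.cos (Real.pi - φ)) *
      gapWeight δ (-α) (Real.pi - φ) =
      -(-(critOffset δ α + δ * Real.cos φ) * gapWeight δ α φ) := fun φ => by
    rw [gapWeight_neg_pi_sub, Real.cos_pi_sub]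
    ring
  simp only [h2, intervalIntegral.integral_neg]
  have h3 := intervalIntegral.integral_add_adjacent_intervals
    (hc.intervalIntegrable 0 θ) (hc.intervalIntegrable (μ := MeasureTheory.volume) θ Real.pi)
  rw [integral_gapGreen_integrand hδ hα] at h3
  linarith

theorem deriv_greenTwo_zero_zero (hδ : 0 < δ) (hδ1 : δ < 1) :
    deriv (fun β => greenTwo β δ 0) 0 = 0 := by
  have h0 : (0 : ℝ) ∈ Ioo (δ - 1) (1 - δ) := ⟨by linarith, by linarith⟩
  have heven : (fun β => greenTwo (-β) δ 0) =ᶠ[𝓝 0] fun β => greenTwo β δ 0 := by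
    filter_upwards [isOpen_Ioo.mem_nhds h0] with β hβ
    have hβ' : -β ∈ Ioo (δ - 1) (1 - δ) := ⟨by linarith [hβ.2], by linarith [hβ.1]⟩
    rw [greenTwo_eq_gapGreen hδ hβ (by simp), greenTwo_eq_gapGreen hδ hβ' (by simp),
      gapGreen_neg_zero hδ hβ]
  have h1 := heven.deriv_eq
  rw [deriv_comp_neg (fun β => greenTwo β δ 0), neg_zero] at h1
  linarith

end Symmetry

/-! ### Vanishing on the bands, positivity in the gap. -/

section Positivity

variable {δ α x : ℝ}

theorem greenTwo_eq_zero (hδ : 0 < δ) (hα : α ∈ Ioo (δ - 1) (1 - δ)) (hx : x ∈ Icc (-1 : ℝ) 1)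
    (hgap : x ∉ Ioo (α - δ) (α + δ)) : greenTwo α δ x = 0 := by
  rw [greenTwo_eq_gapGreen hδ hα hx]
  by_cases h1 : x ≤ α - δ
  · exact gapGreen_of_le hδ hα h1
  · refine gapGreen_of_ge hδ ?_
    by_contra h2
    exact hgap ⟨not_le.1 h1, not_le.1 h2⟩

/-- The integrand changes sign once, from negative to positive, and has total integral zero.
According to its sign at `θ`, either the part over $[\theta,\pi]$ is positive or the part over
$[0,\theta]$ is negative. -/
theorem greenTwo_pos (hδ : 0 < δ) (hα : α ∈ Ioo (δ - 1) (1 - δ))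
    (hx : x ∈ Ioo (α - δ) (α + δ)) : 0 < greenTwo α δ x := by
  rw [greenTwo_eq_gapGreen hδ hα (gap_subset_Icc hα hx), gapGreen]
  have hc := continuous_gapGreen_integrand hδ hα (critOffset δ α)
  obtain ⟨h0, hπ⟩ := arccos_mem_Ioo hδ hx
  set θ := Real.arccos ((α - x) / δ)
  rcases le_or_gt (critOffset δ α + δ * Real.cos θ) 0 with hneg | hpos
  · refine intervalIntegral.intervalIntegral_pos_of_pos_on (hc.intervalIntegrable _ _)
      (fun φ hφ => ?_) hπ
    have := Real.cos_lt_cos_of_nonneg_of_le_pi h0.le hφ.2.le hφ.1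
    exact mul_pos (by nlinarith) (gapWeight_pos hδ hα φ)
  · have h1 : 0 < ∫ φ in 0..θ, -(-(critOffset δ α + δ * Real.cos φ) * gapWeight δ α φ) := by
      refine intervalIntegral.intervalIntegral_pos_of_pos_on (hc.neg.intervalIntegrable _ _)
        (fun φ hφ => ?_) h0
      have := Real.cos_lt_cos_of_nonneg_of_le_pi hφ.1.le hπ.le hφ.2
      have h2 : 0 < critOffset δ α + δ * Real.cos φ := by nlinarith
      nlinarith [mul_pos h2 (gapWeight_pos hδ hα φ)]
    rw [intervalIntegral.integral_neg] at h1
    have h3 := intervalIntegral.integral_add_adjacent_intervals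
      (hc.intervalIntegrable 0 θ) (hc.intervalIntegrable (μ := MeasureTheory.volume) θ Real.pi)
    rw [integral_gapGreen_integrand hδ hα] at h3
    linarith

end Positivity

/-! ### Continuity in the parameter and the limit at the left end. -/

section Limits

variable {δ α x : ℝ}

theorem gapWeight_le_of_le {c φ : ℝ} (hc : 0 < c) (h : c ≤ 1 - (α - δ * Real.cos φ) ^ 2) :
    gapWeight δ α φ ≤ (√c)⁻¹ :=
  inv_anti₀ (Real.sqrt_pos.2 hc) (Real.sqrt_le_sqrt h)

theorem abs_gapGreen_integrand_le {c φ : ℝ} (hδ : 0 < δ) (hα : α ∈ Ioo (δ - 1) (1 - δ))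
    (hc : 0 < c) (h : c ≤ 1 - (α - δ * Real.cos φ) ^ 2) :
    |-(critOffset δ α + δ * Real.cos φ) * gapWeight δ α φ| ≤ 2 * δ * (√c)⁻¹ := by
  rw [abs_mul, abs_neg, abs_of_nonneg (gapWeight_nonneg δ α φ)]
  refine mul_le_mul ?_ (gapWeight_le_of_le hc h) (gapWeight_nonneg _ _ _) (by positivity)
  have hγ := abs_critOffset_lt hδ hα
  rw [abs_le]
  constructor <;> nlinarith [Real.neg_one_le_cos φ, Real.cos_le_one φ]

theorem tendsto_gapWeight {φ : ℝ} (h : 0 < 1 - (α - δ * Real.cos φ) ^ 2) :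
    Tendsto (fun β => gapWeight δ β φ) (𝓝 α) (𝓝 (gapWeight δ α φ)) := by
  have h1 : ContinuousAt (fun β => √(1 - (β - δ * Real.cos φ) ^ 2)) α := by fun_prop
  exact h1.inv₀ (Real.sqrt_pos.2 h).ne'

theorem measurable_gapGreen_integrand (δ γ α : ℝ) :
    Measurable fun φ => -(γ + δ * Real.cos φ) * gapWeight δ α φ := by
  have := measurable_gapWeight δ α
  fun_prop

/-- Bounded convergence is used instead of `hasDerivAt_greenTwo` because `x` may lie on a band or at
an edge of the gap. -/
theorem continuousAt_greenTwo (hδ : 0 < δ) (hα : α ∈ Ioo (δ - 1) (1 - δ))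
    (hx : x ∈ Icc (-1 : ℝ) 1) : ContinuousAt (fun β => greenTwo β δ x) α := by
  have heq : (fun β => gapGreen δ β (critOffset δ β) x) =ᶠ[𝓝 α] fun β => greenTwo β δ x := by
    filter_upwards [isOpen_Ioo.mem_nhds hα] with β hβ
    exact (greenTwo_eq_gapGreen hδ hβ hx).symm
  refine ContinuousAt.congr ?_ heq
  have hp : Continuous fun β : ℝ => (1 + β - δ) * (1 - β - δ) := by fun_prop
  have hp0 : 0 < (1 + α - δ) * (1 - α - δ) :=
    mul_pos (by linarith [hα.1]) (by linarith [hα.2])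
  -- The product bounds $1-x^2$ from below on the gap. Half of its value at `α` remains a lower
  -- bound for nearby parameters.
  set c := (1 + α - δ) * (1 - α - δ) / 2 with hc
  have hcpos : 0 < c := by positivity
  refine tendsto_intervalIntegral_moving (a := -1) (c := Real.pi) (M := 2 * δ * (√c)⁻¹)
    (k := fun β φ => -(critOffset δ β + δ * Real.cos φ) * gapWeight δ β φ)
    (fun β => measurable_gapGreen_integrand δ _ β)
    (Continuous.tendsto (by fun_prop) α) (by linarith [Real.arccos_nonneg ((α - x) / δ)])
    (Eventually.of_forall fun β => Real.arccos_le_pi _) (Real.arccos_le_pi _) ?_ ?_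
  · filter_upwards [isOpen_Ioo.mem_nhds hα,
      hp.continuousAt.eventually (lt_mem_nhds (show c < (1 + α - δ) * (1 - α - δ) by linarith))]
      with β hβ hβc φ _
    refine abs_gapGreen_integrand_le hδ hβ hcpos (hβc.le.trans ?_)
    have h1 : 0 ≤ δ * (1 - Real.cos φ) := mul_nonneg hδ.le (by linarith [Real.cos_le_one φ])
    have h2 : 0 ≤ δ * (1 + Real.cos φ) := mul_nonneg hδ.le (by linarith [Real.neg_one_le_cos φ])
    have h3 : 0 ≤ 1 + β - δ := by linarith [hβ.1]
    have h4 : 0 ≤ 1 - β - δ := by linarith [hβ.2]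
    have h5 : (1 + β - δ) * (1 - β - δ) ≤ (1 + β - δ * Real.cos φ) * (1 - β + δ * Real.cos φ) :=
      mul_le_mul (by linarith) (by linarith) h4 (by linarith)
    linarith
  · intro φ _
    exact ((((hasDerivAt_critOffset hδ hα).continuousAt.tendsto.add_const _)).neg).mul
      (tendsto_gapWeight (radicand_pos (gapPoint_mem hδ hα φ)))

/-- With $s^2=2(1+\alpha-\delta)$ the radicand is at most $s^2+\varphi^2\le(s+\varphi)^2$, so the
weight dominates $1/(s+\varphi)$. As $\alpha\to\delta-1$, $s\to0$ and the bound diverges. -/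
theorem log_le_integral_gapWeight (hδ : 0 < δ) (hα : α ∈ Ioo (δ - 1) (1 - δ)) (hδ1 : δ < 1) :
    Real.log ((√(2 * (1 + α - δ)) + Real.pi) / √(2 * (1 + α - δ))) ≤
      ∫ φ in 0..Real.pi, gapWeight δ α φ := by
  set s := √(2 * (1 + α - δ)) with hs
  have hspos : 0 < s := Real.sqrt_pos.2 (by linarith [hα.1])
  have hs2 : s ^ 2 = 2 * (1 + α - δ) := Real.sq_sqrt (by linarith [hα.1])
  have hlog : ∫ φ in 0..Real.pi, (s + φ)⁻¹ = Real.log ((s + Real.pi) / s) := by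
    rw [intervalIntegral.integral_comp_add_left (fun t : ℝ => t⁻¹) s, add_zero,
      integral_inv_of_pos hspos (by linarith [Real.pi_pos])]
  rw [← hlog]
  refine intervalIntegral.integral_mono_on Real.pi_pos.le ?_
    ((continuous_gapWeight hδ hα).intervalIntegrable _ _) fun φ hφ => ?_
  · refine ContinuousOn.intervalIntegrable ?_
    rw [uIcc_of_le Real.pi_pos.le]
    exact ContinuousOn.inv₀ (by fun_prop) fun φ hφ => by linarith [hφ.1]
  · refine inv_anti₀ (Real.sqrt_pos.2 (radicand_pos (gapPoint_mem hδ hα φ))) ?_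
    rw [Real.sqrt_le_left (by linarith [hφ.1])]
    have hx := gapPoint_mem hδ hα φ
    have hcos := Real.one_sub_sq_div_two_le_cos (x := φ)
    have h1 : 1 - (α - δ * Real.cos φ) ^ 2 ≤ 2 * (1 + (α - δ * Real.cos φ)) := by
      nlinarith [hx.1, hx.2]
    have h2 : δ * (1 - Real.cos φ) ≤ φ ^ 2 / 2 := by
      nlinarith [Real.cos_le_one φ]
    nlinarith [mul_nonneg hspos.le hφ.1]

/-- Here $(\gamma+\delta)\int w=\delta\int(1-\cos\varphi)w$. The right side stays bounded, as
$1-\cos\varphi$ compensates the singularity at $\varphi=0$, while $\int w$ diverges. -/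
theorem tendsto_critOffset (hδ : 0 < δ) (hδ1 : δ < 1) :
    Tendsto (critOffset δ) (𝓝[>] (δ - 1)) (𝓝 (-δ)) := by
  have hev : ∀ᶠ β in 𝓝[>] (δ - 1), β ∈ Ioo (δ - 1) 0 :=
    Ioo_mem_nhdsGT (by linarith)
  have hs : Tendsto (fun β => √(2 * (1 + β - δ))) (𝓝[>] (δ - 1)) (𝓝[>] 0) := by
    refine tendsto_nhdsWithin_iff.2 ⟨?_, ?_⟩
    · have h1 : Continuous fun β : ℝ => √(2 * (1 + β - δ)) := by fun_prop
      have h2 := h1.tendsto (δ - 1)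
      rw [show 2 * (1 + (δ - 1) - δ) = 0 by ring, Real.sqrt_zero] at h2
      exact h2.mono_left nhdsWithin_le_nhds
    · filter_upwards [hev] with β hβ
      exact Real.sqrt_pos.2 (by linarith [hβ.1])
  have hI : Tendsto (fun β => ∫ φ in 0..Real.pi, gapWeight δ β φ) (𝓝[>] (δ - 1)) atTop := by
    have h1 : Tendsto (fun s : ℝ => (s + Real.pi) / s) (𝓝[>] 0) atTop := by
      have h2 : Tendsto (fun s : ℝ => 1 + Real.pi * s⁻¹) (𝓝[>] 0) atTop :=
        tendsto_atTop_add_const_left _ _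
          (tendsto_inv_nhdsGT_zero.const_mul_atTop Real.pi_pos)
      refine h2.congr' ?_
      filter_upwards [self_mem_nhdsWithin] with s hs
      have : s ≠ 0 := (mem_Ioi.1 hs).ne'
      field_simp
    refine tendsto_atTop_mono' _ ?_ (Real.tendsto_log_atTop.comp (h1.comp hs))
    filter_upwards [hev] with β hβ
    exact log_le_integral_gapWeight hδ ⟨hβ.1, by linarith [hβ.2]⟩ hδ1
  set C := 2 * (√(δ * (1 - δ)))⁻¹ with hC
  have hnum : ∀ᶠ β in 𝓝[>] (δ - 1),
      |critOffset δ β + δ| ≤ δ * (C * Real.pi) / ∫ φ in 0..Real.pi, gapWeight δ β φ := by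
    filter_upwards [hev] with β hβ
    have hβ' : β ∈ Ioo (δ - 1) (1 - δ) := ⟨hβ.1, by linarith [hβ.2]⟩
    have hK := continuous_gapWeight hδ hβ'
    have hIpos := integral_gapWeight_pos hδ hβ'
    have hγ := critOffset_mul hδ hβ'
    have hbound : ∀ φ ∈ Icc 0 Real.pi, (1 - Real.cos φ) * gapWeight δ β φ ≤ C := by
      intro φ _
      have hx := gapPoint_mem hδ hβ' φ
      have hcos := Real.neg_one_le_cos φ
      rcases (Real.cos_le_one φ).eq_or_lt with h1 | h1
      · rw [h1]
        simp only [sub_self, zero_mul]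
        positivity
      set t := 1 - Real.cos φ
      have ht : 0 < t := by simp only [t]; linarith
      have ht2 : t ≤ 2 := by simp only [t]; linarith
      have hd1 : 0 < 1 - δ := by linarith
      have hle : δ * (1 - δ) * t ≤ 1 - (β - δ * Real.cos φ) ^ 2 := by
        have h2 : δ * t ≤ 1 + (β - δ * Real.cos φ) := by simp only [t]; linarith [hβ.1]
        have h3 : 1 - δ ≤ 1 - (β - δ * Real.cos φ) := by nlinarith [hβ.2]
        nlinarith [mul_le_mul h2 h3 hd1.le (by linarith [hx.1])]
      have hw := gapWeight_le_of_le (by positivity) hle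
      have hst : √t * √t = t := Real.mul_self_sqrt ht.le
      have hst2 : √t ≤ 2 := by
        rw [Real.sqrt_le_left (by norm_num)]; linarith
      have hsp : 0 < √t := Real.sqrt_pos.2 ht
      calc t * gapWeight δ β φ ≤ t * (√(δ * (1 - δ) * t))⁻¹ :=
            mul_le_mul_of_nonneg_left hw ht.le
        _ = √t * (√(δ * (1 - δ)))⁻¹ := by
            rw [Real.sqrt_mul (by positivity), mul_inv]
            nth_rewrite 1 [← hst]
            field_simp
        _ ≤ C := mul_le_mul_of_nonneg_right hst2 (by positivity)
    have hint : ∫ φ in 0..Real.pi, (1 - Real.cos φ) * gapWeight δ β φ ≤ C * Real.pi := by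
      have h1 := intervalIntegral.integral_mono_on (μ := MeasureTheory.volume) Real.pi_pos.le
        (Continuous.intervalIntegrable (by fun_prop) _ _) intervalIntegrable_const hbound
      simpa [mul_comm] using h1
    have hsplit : ∫ φ in 0..Real.pi, (1 - Real.cos φ) * gapWeight δ β φ =
        (∫ φ in 0..Real.pi, gapWeight δ β φ) -
          ∫ φ in 0..Real.pi, Real.cos φ * gapWeight δ β φ := by
      rw [← intervalIntegral.integral_sub (hK.intervalIntegrable _ _)
        (Continuous.intervalIntegrable (by fun_prop) _ _)]
      exact intervalIntegral.integral_congr fun φ _ => by ring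
    rw [abs_of_pos (by linarith [(abs_critOffset_lt hδ hβ').1]), le_div_iff₀ hIpos]
    nlinarith
  have hz : Tendsto (fun β => critOffset δ β + δ) (𝓝[>] (δ - 1)) (𝓝 0) :=
    squeeze_zero_norm' hnum (hI.const_div_atTop _)
  have := hz.sub_const δ
  simpa using this

/-- For $x>-1$ the limiting angle `θ` is positive, so the moving limits eventually exceed
$\theta/2$. On $[\theta/2,\pi]$ the integrands are uniformly bounded, away from the singularity at
$\varphi=0$. -/
theorem tendsto_greenTwo (hδ : 0 < δ) (hδ1 : δ < 1) (hx : x ∈ Ioc (-1 : ℝ) 1) :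
    Tendsto (fun β => greenTwo β δ x) (𝓝[>] (δ - 1)) (𝓝 (greenOne δ x)) := by
  have hx' : x ∈ Icc (-1 : ℝ) 1 := ⟨hx.1.le, hx.2⟩
  have hev : ∀ᶠ β in 𝓝[>] (δ - 1), β ∈ Ioo (δ - 1) 0 :=
    Ioo_mem_nhdsGT (by linarith)
  rw [greenOne_eq_gapGreen hδ hδ1 hx']
  have heq : (fun β => gapGreen δ β (critOffset δ β) x) =ᶠ[𝓝[>] (δ - 1)]
      fun β => greenTwo β δ x := by
    filter_upwards [hev] with β hβ
    exact (greenTwo_eq_gapGreen hδ ⟨hβ.1, by linarith [hβ.2]⟩ hx').symm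
  refine Tendsto.congr' heq ?_
  set θ := Real.arccos ((δ - 1 - x) / δ) with hθ
  have hθpos : 0 < θ := by
    rw [hθ, Real.arccos_pos, div_lt_one hδ]
    linarith [hx.1]
  have hθπ : θ ≤ Real.pi := Real.arccos_le_pi _
  have hd1 : 0 < 1 - δ := by linarith
  have hrad : ∀ β ∈ Ico (δ - 1) 0, ∀ φ ∈ Icc (θ / 2) Real.pi,
      δ * (1 - Real.cos (θ / 2)) * (1 - δ) ≤ 1 - (β - δ * Real.cos φ) ^ 2 := by
    intro β hβ φ hφ
    have hcos : Real.cos φ ≤ Real.cos (θ / 2) :=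
      Real.cos_le_cos_of_nonneg_of_le_pi (by linarith) hφ.2 hφ.1
    have h0 : 0 ≤ δ * (1 - Real.cos (θ / 2)) :=
      mul_nonneg hδ.le (by linarith [Real.cos_le_one (θ / 2)])
    have h2 : δ * (1 - Real.cos (θ / 2)) ≤ 1 + (β - δ * Real.cos φ) := by
      nlinarith [hβ.1]
    have h3 : 1 - δ ≤ 1 - (β - δ * Real.cos φ) := by
      nlinarith [hβ.2, Real.neg_one_le_cos φ]
    nlinarith [mul_le_mul h2 h3 hd1.le (h0.trans h2)]
  have hcpos : 0 < δ * (1 - Real.cos (θ / 2)) * (1 - δ) := by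
    have h1 : Real.cos (θ / 2) < Real.cos 0 :=
      Real.cos_lt_cos_of_nonneg_of_le_pi le_rfl (by linarith) (by linarith)
    rw [Real.cos_zero] at h1
    have : 0 < 1 - Real.cos (θ / 2) := by linarith
    positivity
  refine tendsto_intervalIntegral_moving (a := θ / 2) (c := Real.pi)
    (M := 2 * δ * (√(δ * (1 - Real.cos (θ / 2)) * (1 - δ)))⁻¹)
    (k := fun β φ => -(critOffset δ β + δ * Real.cos φ) * gapWeight δ β φ)
    (fun β => measurable_gapGreen_integrand δ _ β)
    (((Continuous.tendsto (by fun_prop) (δ - 1)).mono_left nhdsWithin_le_nhds)) (by linarith)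
    (Eventually.of_forall fun β => Real.arccos_le_pi _) hθπ ?_ ?_
  · filter_upwards [hev] with β hβ φ hφ
    exact abs_gapGreen_integrand_le hδ ⟨hβ.1, by linarith [hβ.2]⟩ hcpos
      (hrad β ⟨hβ.1.le, hβ.2⟩ φ hφ)
  · intro φ hφ
    have h1 : 0 < 1 - (δ - 1 - δ * Real.cos φ) ^ 2 :=
      hcpos.trans_le (hrad (δ - 1) ⟨le_rfl, by linarith⟩ φ hφ)
    exact ((tendsto_critOffset hδ hδ1).add_const _).neg.mul
      ((tendsto_gapWeight h1).mono_left nhdsWithin_le_nhds)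

end Limits

/-! ### The upper envelope: attained maximum or boundary limit. -/

section Envelope

variable {δ x : ℝ}

theorem Ioc_subset_Ioo_of_lt_one (hδ1 : δ < 1) : Ioc (δ - 1) 0 ⊆ Ioo (δ - 1) (1 - δ) :=
  fun _ hα => ⟨hα.1, by linarith [hα.2]⟩

/-- Either the supremum over `α` is attained, or it is the limit at the left end. -/
theorem bddAbove_and_attained_or_limit {f : ℝ → ℝ} {a b L : ℝ} (hab : a < b)
    (hf : ContinuousOn f (Ioc a b)) (hL : Tendsto f (𝓝[>] a) (𝓝 L)) :
    BddAbove (f '' Ioc a b) ∧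
      ((∃ t ∈ Ioc a b, f t = sSup (f '' Ioc a b)) ∨ L = sSup (f '' Ioc a b)) := by
  classical
  -- Giving `f` the value `L` at `a` makes it continuous on a compact interval; the two cases are
  -- whether its maximum point differs from `a` or equals it.
  have hcont : ContinuousOn (Function.update f a L) (Icc a b) := by
    rw [continuousOn_update_iff]
    have hsdiff : Icc a b \ {a} = Ioc a b := Icc_sdiff_left
    rw [hsdiff]
    exact ⟨hf, fun _ => hL.mono_left (nhdsWithin_mono _ fun t ht => ht.1)⟩
  have heq : ∀ t ∈ Ioc a b, Function.update f a L t = f t := fun t ht =>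
    Function.update_of_ne ht.1.ne' _ _
  obtain ⟨m, hm, hmax⟩ := isCompact_Icc.exists_isMaxOn (nonempty_Icc.2 hab.le) hcont
  have hub : ∀ t ∈ Ioc a b, f t ≤ Function.update f a L m := fun t ht => by
    rw [← heq t ht]
    exact hmax ⟨ht.1.le, ht.2⟩
  have hbdd : BddAbove (f '' Ioc a b) := ⟨_, forall_mem_image.2 hub⟩
  have hne : (f '' Ioc a b).Nonempty := ⟨_, b, ⟨hab, le_rfl⟩, rfl⟩
  refine ⟨hbdd, ?_⟩
  rcases hm.1.eq_or_lt with h | h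
  · right
    rw [← h, Function.update_self] at hub
    refine le_antisymm ?_ (csSup_le hne (forall_mem_image.2 hub))
    refine le_of_tendsto hL ?_
    filter_upwards [Ioc_mem_nhdsGT hab] with t ht
    exact le_csSup hbdd (mem_image_of_mem f ht)
  · left
    have hm' : m ∈ Ioc a b := ⟨h, hm.2⟩
    rw [heq m hm'] at hub
    exact ⟨m, hm', le_antisymm (le_csSup hbdd (mem_image_of_mem f hm'))
      (csSup_le hne (forall_mem_image.2 hub))⟩

theorem exists_mem_gap (hδ : 0 < δ) (hδ1 : δ < 1) (hx : x ∈ Ioc (-1 : ℝ) 0) :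
    ∃ α ∈ Ioc (δ - 1) 0, x ∈ Ioo (α - δ) (α + δ) := by
  rcases lt_or_ge (-δ) x with h | h
  · exact ⟨0, ⟨by linarith, le_rfl⟩, by linarith, by linarith [hx.2]⟩
  · have h1 := le_max_left (δ - 1) (x - δ)
    have h2 := le_max_right (δ - 1) (x - δ)
    -- The constraints on the centre are $\delta-1<\alpha\le0$ and $x-\delta<\alpha<x+\delta$. Since
    -- $x+\delta\le0$ here, the midpoint of the resulting interval serves.
    have h3 : max (δ - 1) (x - δ) < x + δ := max_lt (by linarith [hx.1]) (by linarith)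
    refine ⟨(max (δ - 1) (x - δ) + (x + δ)) / 2, ⟨?_, ?_⟩, ?_, ?_⟩ <;> linarith

theorem deriv_nonneg_of_forall_le_left {f : ℝ → ℝ} {a b : ℝ} (hab : a < b)
    (hf : DifferentiableAt ℝ f b) (hmax : ∀ t ∈ Ioc a b, f t ≤ f b) : 0 ≤ deriv f b := by
  have h := (hasDerivAt_iff_tendsto_slope_left_right.1 hf.hasDerivAt).1
  refine ge_of_tendsto h ?_
  filter_upwards [Ioo_mem_nhdsLT hab] with t ht
  rw [slope_def_field]
  exact div_nonneg_of_nonpos (by linarith [hmax t ⟨ht.1, ht.2.le⟩]) (by linarith [ht.2])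

/-- The delicate case is the endpoint $\alpha=0$, where maximality gives only $\partial_\alpha
G\ge0$. The derivative vanishes at $x=0$ by symmetry and is strictly increasing in $x$, so it would
be negative for $x<0$; hence $x=0$. -/
theorem deriv_greenTwo_eq_zero_of_max (hδ : 0 < δ) (hδ1 : δ < 1) (hx : x ∈ Ioc (-1 : ℝ) 0)
    {α : ℝ} (hα : α ∈ Ioc (δ - 1) 0) (hgap : x ∈ Ioo (α - δ) (α + δ))
    (hmax : ∀ β ∈ Ioc (δ - 1) 0, greenTwo β δ x ≤ greenTwo α δ x) :
    deriv (fun β => greenTwo β δ x) α = 0 := by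
  rcases hα.2.eq_or_lt with rfl | hneg
  · have h0 : (0 : ℝ) ∈ Ioo (δ - 1) (1 - δ) := Ioc_subset_Ioo_of_lt_one hδ1 hα
    have hderiv := deriv_nonneg_of_forall_le_left (by linarith)
      (hasDerivAt_greenTwo hδ h0 hgap).differentiableAt hmax
    rcases hx.2.eq_or_lt with rfl | hxneg
    · exact deriv_greenTwo_zero_zero hδ hδ1
    · have h1 : deriv (fun β => greenTwo β δ x) 0 < deriv (fun β => greenTwo β δ 0) 0 :=
        strictMonoOn_deriv_greenTwo hδ h0 hgap ⟨by linarith, by linarith⟩ hxneg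
      rw [deriv_greenTwo_zero_zero hδ hδ1] at h1
      exact absurd hderiv (not_le.2 h1)
  · refine IsLocalMax.deriv_eq_zero ?_
    filter_upwards [Ioo_mem_nhds hα.1 hneg] with β hβ
    exact hmax β ⟨hβ.1, hβ.2.le⟩

end Envelope

theorem mainTheorem5 (δ : ℝ) (hδ0 : 0 < δ) (hδ1 : δ < 1) :
    (∀ α ∈ Ioc (δ - 1) 0,
      (∀ x ∈ Ioo (α - δ) (α + δ), DifferentiableAt ℝ (fun β : ℝ => greenTwo β δ x) α) ∧
      ∃! x : ℝ, x ∈ Ioo (α - δ) (α + δ) ∧ deriv (fun β : ℝ => greenTwo β δ x) α = 0) ∧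
    ∀ x₀ ∈ Ioc (-1 : ℝ) 0,
      BddAbove ((fun α : ℝ => greenTwo α δ x₀) '' Ioc (δ - 1) 0) ∧
      (∀ α ∈ Ioc (δ - 1) 0, greenTwo α δ x₀ = upperEnvelope δ x₀ →
        x₀ ∈ Ioo (α - δ) (α + δ) ∧
        deriv (fun β : ℝ => greenTwo β δ x₀) α = 0 ∧
        ∀ x ∈ Ioo (α - δ) (α + δ), deriv (fun β : ℝ => greenTwo β δ x) α = 0 → x = x₀) ∧
      ((¬ ∃ α ∈ Ioc (δ - 1) 0, greenTwo α δ x₀ = upperEnvelope δ x₀) →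
        Tendsto (fun α : ℝ => greenTwo α δ x₀) (𝓝[>] (δ - 1)) (𝓝 (upperEnvelope δ x₀)) ∧
        upperEnvelope δ x₀ = greenOne δ x₀) := by
  have hsub := Ioc_subset_Ioo_of_lt_one hδ1
  refine ⟨fun α hα => ⟨fun x hx => (hasDerivAt_greenTwo hδ0 (hsub hα) hx).differentiableAt, ?_⟩,
    fun x₀ hx₀ => ?_⟩
  · obtain ⟨x, hx, hx0⟩ := exists_deriv_greenTwo_eq_zero hδ0 (hsub hα)
    refine ⟨x, ⟨hx, hx0⟩, fun y hy => ?_⟩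
    exact (strictMonoOn_deriv_greenTwo hδ0 (hsub hα)).injOn hy.1 hx (hy.2.trans hx0.symm)
  · have hxI : x₀ ∈ Icc (-1 : ℝ) 1 := ⟨hx₀.1.le, by linarith [hx₀.2]⟩
    have hlim := tendsto_greenTwo hδ0 hδ1 (x := x₀) ⟨hx₀.1, by linarith [hx₀.2]⟩
    obtain ⟨hbdd, hor⟩ := bddAbove_and_attained_or_limit (by linarith)
      (fun α hα => (continuousAt_greenTwo hδ0 (hsub hα) hxI).continuousWithinAt) hlim
    refine ⟨hbdd, fun α hα hatt => ?_, fun hnot => ?_⟩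
    · have hmax : ∀ β ∈ Ioc (δ - 1) 0, greenTwo β δ x₀ ≤ greenTwo α δ x₀ := fun β hβ => by
        rw [hatt]
        exact le_csSup hbdd ⟨β, hβ, rfl⟩
      -- Outside its gap the Green function is zero at `x₀`, which cannot be maximal because another
      -- admissible gap contains `x₀` and gives a positive value.
      have hgap : x₀ ∈ Ioo (α - δ) (α + δ) := by
        by_contra hgap
        obtain ⟨β, hβ, hβx⟩ := exists_mem_gap hδ0 hδ1 hx₀
        have h1 := greenTwo_pos hδ0 (hsub hβ) hβx
        have h2 := hmax β hβ
        rw [greenTwo_eq_zero hδ0 (hsub hα) hxI hgap] at h2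
        linarith
      have hderiv := deriv_greenTwo_eq_zero_of_max hδ0 hδ1 hx₀ hα hgap hmax
      refine ⟨hgap, hderiv, fun x hx hx0 => ?_⟩
      exact (strictMonoOn_deriv_greenTwo hδ0 (hsub hα)).injOn hx hgap (hx0.trans hderiv.symm)
    · have heq : greenOne δ x₀ = upperEnvelope δ x₀ := hor.resolve_left hnot
      exact ⟨heq ▸ hlim, heq.symm⟩
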